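/- **Setting.** Let $f:\mathbb R^n\to\mathbb R$, let $x_k\in\mathbb R^n$ be the current iterate, $\Delta>0$, and let $D=GZ\in\mathbb R^{n\times p}$ with $G\in\mathbb R^{n\times n}$ nonsingular, $Z$ an integer matrix, and the columns of $D$ a positive spanning set of $\mathbb R^n$. Let $X$ be a set of $N$ points of the mesh $\{x_k+\Delta Dz: z\in\mathbb N^p\}$, exactly $t$ of which are improved mesh points, i.e. satisfy $f(x)<f(x_k)$. Reals are encoded in $d$-bit fixed-point two's complement, points of $\mathbb R^n$ coordinatewise in $dn$ bits; the precision is assumed sufficient: distinct points of $X$ have distinct encodings, $f(x)<f(x_k)$ implies the same strict inequality between the encoded values ($x\in X$), and the differences of the encoded values of $f(x)$ and $f(x_k)$ do not overflow the $d$-bit range. Let $F$ be a unitary (the quantum oracle) with $F|x\rangle|0\rangle=|x\rangle|f(x)\rangle$ for $x\in X$. **The operators.** On three registers (point, value, comparison), $\mathcal A$ is the following circuit: put the comparison register into the state $|-f(x_k)\rangle$; apply to the point register a unitary $W$ with $W|0\rangle=N^{-1/2}\sum_{x\in X}|x\rangle$; apply $F$ to the first two registers; add the value register into the comparison register by the QFT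 adder (a QFT of the comparison register, phase rotations controlled by the value register, an inverse QFT). A basis state is *desired* if the sign bit of its comparison register is $1$. Let $S_\chi$ flip the sign of the desired basis states, let $S_0$ flip the sign of $|0\rangle$ only, and let $Q=-\mathcal A S_0\mathcal A^{-1}S_\chi$. **The quantum search step**, with tolerance $\tau>0$ and a constant $1<c<2$, is modified QSearch: set $l=u=0$; measure $\mathcal A|0\rangle$ and return the result if it is desired. While nothing has been returned and $u<\ln\tau/\ln\frac34$: increase $l$ by $1$; put $M=\lceil c^l\rceil$; if $M>\sqrt N$, increase $u$ by $1$; draw $j$ uniformly from $\{1,\dots,M\}$; measure $Q^j\mathcal A|0\rangle$ and return the result if it is desired. If the loop ends without a result, report failure. Every use of $F$ or $F^{-1}$ counts as one oracle call. **Theorem.** For every $c\in(1,2)$ there are constants $\kappa_1,\kappa_2>0$, depending only on $c$, such that in every setting as above: 1. The quantum search step terminates after a number of steps bounded in terms of its inputs, and in every execution exactly one of two cases holds: it returns (the encoding of) an improved mesh point of $X$, or it terminates reporting failure. 2. If $t>0$, the probability that it terminates without finding an improved mesh point is less than $\tau$, so this probability can be made arbitrarily small. 3. If $t>0$, the expected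 number of oracle calls, and also the expected number of oracle calls conditioned on an improved mesh point being returned, is at most $\kappa_2\sqrt{N/t}$, and if moreover $\tau<1$ it is at least $\kappa_1\sqrt{N/t}$. In particular both are $\Theta(\sqrt{N/t})$ for every fixed $\tau\in(0,1)$. -/

import Mathlib

open scoped ENNReal Kronecker

noncomputable section

namespace QuantumSearch

/-! ## Generalized pattern search: the mesh and improved mesh points -/

/-- `D = G Z` with `G` nonsingular and `Z` integral, and the columns of `D` form a positive
spanning set of `ℝⁿ`. -/
def IsPatternMatrix {n p : ℕ} (D : Matrix (Fin n) (Fin p) ℝ) : Prop :=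
  (∃ (G : Matrix (Fin n) (Fin n) ℝ) (Z : Matrix (Fin n) (Fin p) ℤ),
      G.det ≠ 0 ∧ D = G * Z.map (fun z : ℤ => (z : ℝ))) ∧
    ∀ v : Fin n → ℝ, ∃ a : Fin p → ℝ, (∀ i, 0 ≤ a i) ∧ D.mulVec a = v

/-- The mesh `{x_k + Δ D z : z ∈ ℕᵖ}` around the current iterate `x_k`. -/
def mesh {n p : ℕ} (xk : Fin n → ℝ) (Δ : ℝ) (D : Matrix (Fin n) (Fin p) ℝ) : Set (Fin n → ℝ) :=
  {y | ∃ z : Fin p → ℕ, y = xk + Δ • D.mulVec (fun i => (z i : ℝ))}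

/-- An improved mesh point: a mesh point with objective value strictly below that of `x_k`. -/
def IsImprovedMeshPoint {n p : ℕ} (f : (Fin n → ℝ) → ℝ) (xk : Fin n → ℝ) (Δ : ℝ)
    (D : Matrix (Fin n) (Fin p) ℝ) (y : Fin n → ℝ) : Prop :=
  y ∈ mesh xk Δ D ∧ f y < f xk

open Classical in
/-- The improved mesh points among the points of `X`. -/
def improvedMeshPoints {n p : ℕ} (f : (Fin n → ℝ) → ℝ) (xk : Fin n → ℝ) (Δ : ℝ)
    (D : Matrix (Fin n) (Fin p) ℝ) (X : Finset (Fin n → ℝ)) : Finset (Fin n → ℝ) :=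
  X.filter (IsImprovedMeshPoint f xk Δ D)

/-! ## Unitary matrices, circuits with oracle gates, and measurement

A register of `m` qubits has the computational basis `BitVec m` (bit strings of length `m`); a
composite register is indexed by the product of the index types. -/

/-- The diagonal gate `|i⟩ ↦ φ i |i⟩`, where every `φ i` has modulus one. -/
def diagonalGate {ι : Type} [Fintype ι] [DecidableEq ι] (φ : ι → ℂ) (hφ : ∀ i, ‖φ i‖ = 1) :
    Matrix.unitaryGroup ι ℂ :=
  ⟨Matrix.diagonal φ, by
    rw [Matrix.mem_unitaryGroup_iff, Matrix.star_eq_conjTranspose,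
      Matrix.diagonal_conjTranspose, Matrix.diagonal_mul_diagonal, ← Matrix.diagonal_one]
    congr 1
    funext i
    simp [Complex.mul_conj, Complex.normSq_eq_norm_sq, hφ i]⟩

/-- The gate that flips the sign of the basis states satisfying `P` and fixes the others. -/
def signFlip {ι : Type} [Fintype ι] [DecidableEq ι] (P : ι → Prop) [DecidablePred P] :
    Matrix.unitaryGroup ι ℂ :=
  diagonalGate (fun i => if P i then -1 else 1) (fun i => by split_ifs <;> simp)

/-- The gate applying `U` to the first of two registers. -/
def onLeft {α β : Type} [Fintype α] [DecidableEq α] [Fintype β] [DecidableEq β]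
    (U : Matrix.unitaryGroup α ℂ) : Matrix.unitaryGroup (α × β) ℂ :=
  ⟨U.1 ⊗ₖ (1 : Matrix β β ℂ), Matrix.kronecker_mem_unitary U.2 (one_mem _)⟩

/-- The gate applying `U` to the second of two registers. -/
def onRight {α β : Type} [Fintype α] [DecidableEq α] [Fintype β] [DecidableEq β]
    (U : Matrix.unitaryGroup β ℂ) : Matrix.unitaryGroup (α × β) ℂ :=
  ⟨(1 : Matrix α α ℂ) ⊗ₖ U.1, Matrix.kronecker_mem_unitary (one_mem _) U.2⟩

/-- A gate of a circuit: an ordinary unitary gate, a call to the oracle, or a call to the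
inverse of the oracle. -/
inductive Gate (ι : Type) [Fintype ι] [DecidableEq ι] : Type
  | free (U : Matrix.unitaryGroup ι ℂ) : Gate ι
  | oracle : Gate ι
  | oracleInv : Gate ι

/-- The unitary matrix performed by a gate, for the oracle `O`. -/
def Gate.eval {ι : Type} [Fintype ι] [DecidableEq ι] (O : Matrix.unitaryGroup ι ℂ) :
    Gate ι → Matrix.unitaryGroup ι ℂ
  | .free U => U
  | .oracle => O
  | .oracleInv => O⁻¹

/-- The inverse gate. -/
def Gate.inv {ι : Type} [Fintype ι] [DecidableEq ι] : Gate ι → Gate ι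
  | .free U => .free U⁻¹
  | .oracle => .oracleInv
  | .oracleInv => .oracle

/-- The number of oracle calls made by a gate. -/
def Gate.calls {ι : Type} [Fintype ι] [DecidableEq ι] : Gate ι → ℕ
  | .free _ => 0
  | .oracle => 1
  | .oracleInv => 1

/-- A measurement-free quantum algorithm, as the list of its gates in the order of time. -/
abbrev Circuit (ι : Type) [Fintype ι] [DecidableEq ι] : Type := List (Gate ι)

/-- The unitary matrix performed by a circuit. -/
def Circuit.eval {ι : Type} [Fintype ι] [DecidableEq ι] (O : Matrix.unitaryGroup ι ℂ) :
    Circuit ι → Matrix.unitaryGroup ι ℂ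
  | [] => 1
  | g :: C => Circuit.eval O C * g.eval O

/-- The inverse circuit. -/
def Circuit.inv {ι : Type} [Fintype ι] [DecidableEq ι] (C : Circuit ι) : Circuit ι :=
  (C.map Gate.inv).reverse

/-- The number of oracle calls made by a circuit. -/
def Circuit.calls {ι : Type} [Fintype ι] [DecidableEq ι] (C : Circuit ι) : ℕ :=
  (C.map Gate.calls).sum

/-- The circuit `C` repeated `j` times. -/
def Circuit.repeat {ι : Type} [Fintype ι] [DecidableEq ι] (C : Circuit ι) (j : ℕ) : Circuit ι :=
  (List.replicate j C).flatten

/-- The columns of a unitary matrix are unit vectors. -/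
theorem sum_sq_norm_column {ι : Type} [Fintype ι] [DecidableEq ι] (U : Matrix.unitaryGroup ι ℂ)
    (i : ι) : ∑ b, ENNReal.ofReal (‖U.1 b i‖ ^ 2) = 1 := by
  rw [← ENNReal.ofReal_sum_of_nonneg (fun b _ => by positivity)]
  have h := congrFun (congrFun (Matrix.UnitaryGroup.star_mul_self U) i) i
  rw [Matrix.mul_apply, Matrix.one_apply_eq] at h
  have h2 : ((∑ b, ‖U.1 b i‖ ^ 2 : ℝ) : ℂ) = 1 := by
    rw [← h]
    push_cast
    refine Finset.sum_congr rfl fun b _ => ?_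
    rw [Matrix.star_apply, Complex.star_def, Complex.conj_mul']
  rw [show (∑ b, ‖U.1 b i‖ ^ 2 : ℝ) = 1 by exact_mod_cast h2, ENNReal.ofReal_one]

/-- Measurement of all qubits in the state `U |i⟩`: the outcome `b` has probability
`|⟨b| U |i⟩|²`. -/
def measure {ι : Type} [Fintype ι] [DecidableEq ι] (U : Matrix.unitaryGroup ι ℂ) (i : ι) :
    PMF ι :=
  PMF.ofFintype (fun b => ENNReal.ofReal (‖U.1 b i‖ ^ 2)) (sum_sq_norm_column U i)

/-! ## Modified QSearch -/

/-- The operator `Q = - A S₀ A⁻¹ S_χ` as a circuit: first `S_χ`, then `A⁻¹`, `S₀`, `A` and the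
sign. Here `zero` is the basis state `|0…0⟩` and `good` holds for the desired basis states. -/
def amplification {ι : Type} [Fintype ι] [DecidableEq ι] (A : Circuit ι) (zero : ι)
    (good : ι → Prop) [DecidablePred good] : Circuit ι :=
  [Gate.free (signFlip good)] ++ A.inv ++ [Gate.free (signFlip (fun i => i = zero))] ++ A ++
    [Gate.free (diagonalGate (fun _ => -1) (fun _ => by simp))]

/-- The states of an execution of modified QSearch. Each of them but the first records the number
of oracle calls made so far. -/
inductive SearchState (ι : Type) : Type
  /-- Before the first measurement. -/
  | start : SearchState ι
  /-- At the head of the while loop, with the current values of the counters `l` and `u`. -/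
  | loop (l u calls : ℕ) : SearchState ι
  /-- Halted, returning the desired basis state `b`. -/
  | found (b : ι) (calls : ℕ) : SearchState ι
  /-- Halted, reporting the failure to find a desired state. -/
  | failed (calls : ℕ) : SearchState ι

/-- The number of oracle calls made so far. -/
def SearchState.calls {ι : Type} : SearchState ι → ℕ
  | .start => 0
  | .loop _ _ m => m
  | .found _ m => m
  | .failed m => m

/-- The execution has halted and returned a desired state. -/
def SearchState.IsFound {ι : Type} : SearchState ι → Prop
  | .found _ _ => True
  | _ => False

/-- The execution has halted and reported failure. -/
def SearchState.IsFailed {ι : Type} : SearchState ι → Prop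
  | .failed _ => True
  | _ => False

/-- The set `[1, ⌈c ^ l⌉]` from which the number of applications of `Q` is drawn is not empty. -/
theorem Icc_ceil_nonempty {c : ℝ} (hc : 1 < c) (l : ℕ) :
    (Finset.Icc 1 ⌈c ^ l⌉₊).Nonempty :=
  Finset.nonempty_Icc.2 (Nat.one_le_iff_ne_zero.2 (Nat.ceil_pos.2 (by positivity)).ne')

/-- One step of modified QSearch, for the oracle `O`, the circuit `A`, a search among `N` states,
the tolerance `τ` and the growth factor `c`.

* `start`: apply `A` to `|0…0⟩` and measure; return the result if it is desired, otherwise enter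
  the loop with `l = u = 0`.
* `loop`: if `u < ln τ / ln (3/4)`, increase `l` by one, put `M = ⌈c ^ l⌉`, increase `u` by one
  if `M > √N`, draw `j` uniformly from `[1, M]`, apply `A` and then `j` times `Q` to `|0…0⟩`
  and measure; return the result if it is desired, otherwise go back to the head of the loop.
  If `u ≥ ln τ / ln (3/4)`, report failure.
* halted executions stay as they are. -/
def searchStep {ι : Type} [Fintype ι] [DecidableEq ι] (O : Matrix.unitaryGroup ι ℂ)
    (A : Circuit ι) (zero : ι) (good : ι → Prop) [DecidablePred good] (N : ℕ) (τ c : ℝ)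
    (hc : 1 < c) : SearchState ι → PMF (SearchState ι)
  | .start =>
      (measure (A.eval O) zero).bind fun b =>
        PMF.pure (if good b then .found b A.calls else .loop 0 0 A.calls)
  | .loop l u m =>
      if (u : ℝ) < Real.log τ / Real.log (3 / 4) then
        (PMF.uniformOfFinset (Finset.Icc 1 ⌈c ^ (l + 1)⌉₊) (Icc_ceil_nonempty hc (l + 1))).bind
          fun j =>
            let C : Circuit ι := A ++ (amplification A zero good).repeat j
            (measure (C.eval O) zero).bind fun b =>
              PMF.pure
                (if good b then .found b (m + C.calls)
                else .loop (l + 1) (if Real.sqrt N < ⌈c ^ (l + 1)⌉₊ then u + 1 else u)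
                  (m + C.calls))
      else PMF.pure (.failed m)
  | .found b m => PMF.pure (.found b m)
  | .failed m => PMF.pure (.failed m)

/-- The distribution of the state of modified QSearch after `k` steps. -/
def modifiedQSearch {ι : Type} [Fintype ι] [DecidableEq ι] (O : Matrix.unitaryGroup ι ℂ)
    (A : Circuit ι) (zero : ι) (good : ι → Prop) [DecidablePred good] (N : ℕ) (τ c : ℝ)
    (hc : 1 < c) : ℕ → PMF (SearchState ι)
  | 0 => PMF.pure .start
  | k + 1 => (modifiedQSearch O A zero good N τ c hc k).bind (searchStep O A zero good N τ c hc)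

/-! ## Fixed-point two's complement encoding -/

/-- The integer that represents `y` in fixed-point format with `s` fractional bits. -/
def quantize (s : ℕ) (y : ℝ) : ℤ := ⌊y * 2 ^ s⌋

/-- The `d`-bit two's complement fixed-point encoding of a real number, `s` of the bits being
fractional. -/
def encodeReal (d s : ℕ) (y : ℝ) : BitVec d := BitVec.ofInt d (quantize s y)

/-- A point of `ℝⁿ` is encoded coordinate by coordinate, in `d n` bits. -/
def encodePoint (d s : ℕ) {n : ℕ} (x : Fin n → ℝ) : Fin n → BitVec d :=
  fun i => encodeReal d s (x i)

/-- `d` bits, `s` of them fractional, suffice to represent the search problem: distinct points of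
`X` have distinct encodings, the resolution does not hide an improvement over `x_k`, and no
difference `f x - f x_k` overflows the `d`-bit two's complement range. All this holds if the
coordinates, the objective values and the differences are exactly representable. -/
structure PrecisionSuffices (d s : ℕ) {n : ℕ} (f : (Fin n → ℝ) → ℝ) (xk : Fin n → ℝ)
    (X : Finset (Fin n → ℝ)) : Prop where
  injOn : Set.InjOn (encodePoint d s) (X : Set (Fin n → ℝ))
  resolves : ∀ x ∈ X, f x < f xk → quantize s (f x) < quantize s (f xk)
  no_overflow : ∀ x ∈ X,
    (BitVec.ofInt d (quantize s (f x) - quantize s (f xk))).toInt =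
      quantize s (f x) - quantize s (f xk)

/-! ## The operator `A` of the quantum search step -/

/-- The computational basis of the first register, which holds a point of `ℝⁿ`. -/
abbrev PointReg (n d : ℕ) : Type := Fin n → BitVec d

/-- The computational basis of the three registers (point, objective value, comparison). -/
abbrev Reg (n d : ℕ) : Type := (PointReg n d × BitVec d) × BitVec d

/-- The basis state `|0⟩|0⟩|0⟩`. -/
def zeroReg (n d : ℕ) : Reg n d := ((fun _ => 0#d, 0#d), 0#d)

/-- The sign qubit of the comparison register is in the state `|1⟩`. -/
def signBitSet {n d : ℕ} (b : Reg n d) : Prop := b.2.msb = true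

instance {n d : ℕ} : DecidablePred (signBitSet (n := n) (d := d)) :=
  fun b => inferInstanceAs (Decidable (b.2.msb = true))

/-- `F` is a quantum oracle for `f` on the points of `X`: `F |x⟩|0⟩ = |x⟩|f x⟩` for `x ∈ X`. -/
def IsQuantumOracle (d s : ℕ) {n : ℕ} (f : (Fin n → ℝ) → ℝ) (X : Finset (Fin n → ℝ))
    (F : Matrix.unitaryGroup (PointReg n d × BitVec d) ℂ) : Prop :=
  ∀ x ∈ X, F.1.mulVec (Pi.single (encodePoint d s x, 0#d) 1) =
    Pi.single (encodePoint d s x, encodeReal d s (f x)) 1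

/-- `W` prepares the uniform superposition of the points of `X`:
`W |0⟩ = N^(-1/2) ∑ x ∈ X, |x⟩`, where `N` is the number of points. -/
def PreparesUniform (d s : ℕ) {n : ℕ} (X : Finset (Fin n → ℝ))
    (W : Matrix.unitaryGroup (PointReg n d) ℂ) : Prop :=
  W.1.mulVec (Pi.single (fun _ => 0#d) 1) =
    ∑ x ∈ X, Pi.single (encodePoint d s x) (1 / (Real.sqrt X.card : ℂ))

/-- The gate `|w⟩ ↦ |w xor v⟩` (a NOT on each qubit where `v` has a one); it takes `|0⟩` to
`|v⟩`. -/
def xorGate {d : ℕ} (v : BitVec d) : Matrix.unitaryGroup (BitVec d) ℂ :=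
  ⟨Matrix.of fun i j => if i = j ^^^ v then 1 else 0, by
    have h : ∀ i j : BitVec d, i = j ^^^ v ↔ j = i ^^^ v := fun i j => by
      constructor <;> (intro h; rw [h, BitVec.xor_assoc]; simp)
    rw [Matrix.mem_unitaryGroup_iff]
    ext i j
    simp only [Matrix.mul_apply, Matrix.star_apply, Matrix.of_apply, Matrix.one_apply, h]
    simp [Finset.sum_ite_eq', apply_ite, eq_comm]⟩

/-- The `2^d`-th roots of unity of the quantum Fourier transform, `exp (2 π i a b / 2^d)`. -/
def fourierPhase {d : ℕ} (a b : BitVec d) : ℂ :=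
  Complex.exp (2 * Real.pi * Complex.I * (a.toNat * b.toNat) / 2 ^ d)

theorem norm_fourierPhase {d : ℕ} (a b : BitVec d) : ‖fourierPhase a b‖ = 1 := by
  rw [fourierPhase, show (2 * Real.pi * Complex.I * (a.toNat * b.toNat) / 2 ^ d : ℂ) =
    ((2 * Real.pi * (a.toNat * b.toNat) / 2 ^ d : ℝ) : ℂ) * Complex.I by push_cast; ring]
  exact Complex.norm_exp_ofReal_mul_I _

/-- The matrix of the quantum Fourier transform on a `d`-qubit register. -/
def qftMatrix (d : ℕ) : Matrix (BitVec d) (BitVec d) ℂ :=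
  Matrix.of fun a b => fourierPhase a b / (Real.sqrt (2 ^ d) : ℂ)

theorem fourierPhase_eq_stdAddChar {d : ℕ} (a b : BitVec d) :
    fourierPhase a b = ZMod.stdAddChar ((a.toNat : ZMod (2 ^ d)) * (b.toNat : ZMod (2 ^ d))) := by
  have h := ZMod.stdAddChar_coe (N := 2 ^ d) ((a.toNat : ℤ) * (b.toNat : ℤ))
  push_cast at h
  rw [h, fourierPhase]

theorem sum_bitVec_eq_sum_zmod {d : ℕ} (g : ZMod (2 ^ d) → ℂ) :
    ∑ a : BitVec d, g (a.toNat : ZMod (2 ^ d)) = ∑ z : ZMod (2 ^ d), g z := by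
  refine Fintype.sum_bijective (fun a : BitVec d => (a.toNat : ZMod (2 ^ d))) ⟨?_, ?_⟩ _ _
    fun _ => rfl
  · intro a b h
    have h' := (ZMod.natCast_eq_natCast_iff _ _ _).1 h
    exact BitVec.eq_of_toNat_eq (Nat.ModEq.eq_of_lt_of_lt h' a.isLt b.isLt)
  · intro z
    refine ⟨BitVec.ofNat d z.val, ?_⟩
    simp [Nat.mod_eq_of_lt (ZMod.val_lt z)]

theorem qftMatrix_mem (d : ℕ) : qftMatrix d ∈ Matrix.unitaryGroup (BitVec d) ℂ := by
  rw [Matrix.mem_unitaryGroup_iff']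
  ext i j
  have hs : ((Real.sqrt (2 ^ d) : ℝ) : ℂ) * (Real.sqrt (2 ^ d) : ℝ) = 2 ^ d := by
    rw [← Complex.ofReal_mul, Real.mul_self_sqrt (by positivity)]
    push_cast
    rfl
  have key : ∀ a : BitVec d, star (qftMatrix d a i) * qftMatrix d a j =
      ZMod.stdAddChar ((a.toNat : ZMod (2 ^ d)) *
        ((j.toNat : ZMod (2 ^ d)) - (i.toNat : ZMod (2 ^ d)))) / 2 ^ d := by
    intro a
    have hc : (starRingEnd ℂ) (fourierPhase a i) =
        ZMod.stdAddChar (-((a.toNat : ZMod (2 ^ d)) * (i.toNat : ZMod (2 ^ d)))) := by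
      rw [fourierPhase_eq_stdAddChar, AddChar.map_neg_eq_conj]
    simp only [qftMatrix, Matrix.of_apply, Complex.star_def, map_div₀, Complex.conj_ofReal, hc]
    rw [div_mul_div_comm, hs, fourierPhase_eq_stdAddChar, ← AddChar.map_add_eq_mul]
    congr 2
    ring
  simp only [Matrix.mul_apply, Matrix.star_apply, key]
  rw [← Finset.sum_div, sum_bitVec_eq_sum_zmod (fun z => ZMod.stdAddChar
    (z * ((j.toNat : ZMod (2 ^ d)) - (i.toNat : ZMod (2 ^ d))))),
    AddChar.sum_mulShift _ (ZMod.isPrimitive_stdAddChar (2 ^ d))]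
  have hij : ((j.toNat : ZMod (2 ^ d)) - (i.toNat : ZMod (2 ^ d))) = 0 ↔ i = j := by
    rw [sub_eq_zero, ZMod.natCast_eq_natCast_iff]
    constructor
    · intro h
      exact (BitVec.eq_of_toNat_eq (Nat.ModEq.eq_of_lt_of_lt h j.isLt i.isLt)).symm
    · rintro rfl
      rfl
  simp only [hij, Matrix.one_apply, ZMod.card]
  split_ifs <;> simp

/-- The quantum Fourier transform on a `d`-qubit register. -/
def qft (d : ℕ) : Matrix.unitaryGroup (BitVec d) ℂ := ⟨qftMatrix d, qftMatrix_mem d⟩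

/-- The in-place signed QFT adder `|v⟩|w⟩ ↦ |v⟩|w + v⟩` (two's complement) from the second into
the third register: a QFT on the third register, phase rotations of the third register controlled
by the second, and an inverse QFT on the third register. -/
def qftAdder (n d : ℕ) : Circuit (Reg n d) :=
  [Gate.free (onRight (qft d)),
    Gate.free (diagonalGate (fun b => fourierPhase b.1.2 b.2) (fun _ => norm_fourierPhase _ _)),
    Gate.free (onRight (qft d)⁻¹)]

/-- The algorithm `A`: put the third register into the state `|-f_k⟩`, the first into the uniform
superposition of the points, apply the oracle to the first two registers, and add the second
register to the third. `fk` is the encoding of `f x_k`. -/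
def searchCircuit {n d : ℕ} (W : Matrix.unitaryGroup (PointReg n d) ℂ) (fk : BitVec d) :
    Circuit (Reg n d) :=
  [Gate.free (onRight (xorGate (-fk))), Gate.free (onLeft (onLeft W)), Gate.oracle] ++
    qftAdder n d

/-- The quantum search step: modified QSearch with the algorithm `A` above, the oracle `F` acting
on the first two registers, and the desired states marked by the sign qubit of the comparison
register. This is the distribution of its state after `k` steps. -/
def quantumSearchStep {n d : ℕ} (s : ℕ) (f : (Fin n → ℝ) → ℝ) (xk : Fin n → ℝ)
    (X : Finset (Fin n → ℝ)) (F : Matrix.unitaryGroup (PointReg n d × BitVec d) ℂ)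
    (W : Matrix.unitaryGroup (PointReg n d) ℂ) (τ c : ℝ) (hc : 1 < c) (k : ℕ) :
    PMF (SearchState (Reg n d)) :=
  modifiedQSearch (onLeft F) (searchCircuit W (encodeReal d s (f xk))) (zeroReg n d) signBitSet
    X.card τ c hc k

/-! ## Probabilities and expected numbers of oracle calls -/

/-- The probability of an event. -/
def prob {α : Type} (ρ : PMF α) (E : α → Prop) : ℝ≥0∞ := ρ.toOuterMeasure {σ | E σ}

/-- The expected number of oracle calls. -/
def expectedCalls {ι : Type} (ρ : PMF (SearchState ι)) : ℝ≥0∞ := ∑' σ, ρ σ * σ.calls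

open Classical in
/-- The expected number of oracle calls, conditioned on a desired state being returned. -/
def expectedCallsIfFound {ι : Type} (ρ : PMF (SearchState ι)) : ℝ≥0∞ :=
  (∑' σ, if σ.IsFound then ρ σ * σ.calls else 0) / prob ρ SearchState.IsFound

end QuantumSearch

end

open QuantumSearch

noncomputable section

namespace QuantumSearch

/-! ## Circuits and amplitude amplification -/

section Circuits

variable {ι : Type} [Fintype ι] [DecidableEq ι]

/-! The search circuit spreads the zero state evenly over `N` distinct basis states, `t` of them
desired, so measuring it succeeds with probability `sin² θ = t / N`. Amplification rotates by `2θ`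
in the span of the desired and undesired parts of that state, so after `j` rounds the success
probability is `sin² ((2j+1)θ)` (`weight_amplified`). The search becomes a Markov chain, and each
quantitative claim is a supermartingale argument: a potential that does not increase in expectation
dominates the quantity in question (`expect_potential_le`).

Failure: averaged over `j`, an iteration with `M > √N` fails with probability at most `3/4`
(`failMean_le_three_quarters`), and giving up requires `⌈ln τ / ln (3/4)⌉` of them. The factor `cos²
θ` of the first measurement makes the bound strict.

Upper bound: once `M sin 2θ` is large, the failure probability of an iteration is near `1/2`, hence
below `1/c` because `c < 2`. Costs growing like `c ^ l`, weighted by survival probabilities, then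
form a convergent geometric series, and the expected cost of the loop is `O(1 / sin 2θ)`
(`exists_cost_bound`). The probability `cos² θ` of entering the loop turns this into `O(1 / sin θ) =
O(√(N/t))`.

Lower bound: `|sin ((2j+1)θ)| ≤ (2j+1) |sin θ|` makes a success within fewer than `B` calls have
probability `O(B² t / N)` (`prob_found_early_le`). For `τ < 1` success has probability at least
`1/4`, so with `B` a small multiple of `√(N/t)` a success costing at least `B` calls keeps
probability at least `1/8`.

Termination: `l` grows at every iteration, and `u`, which is bounded, at all but finitely many. -/

theorem Circuit.eval_append (O : Matrix.unitaryGroup ι ℂ) (C D : Circuit ι) :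
    Circuit.eval O (C ++ D) = Circuit.eval O D * Circuit.eval O C := by
  induction C with
  | nil => simp [Circuit.eval]
  | cons g C ih => simp [Circuit.eval, ih, mul_assoc]

theorem Gate.eval_inv (O : Matrix.unitaryGroup ι ℂ) (g : Gate ι) :
    g.inv.eval O = (g.eval O)⁻¹ := by
  cases g <;> simp [Gate.inv, Gate.eval]

theorem Circuit.eval_inv (O : Matrix.unitaryGroup ι ℂ) (C : Circuit ι) :
    Circuit.eval O (Circuit.inv C) = (Circuit.eval O C)⁻¹ := by
  induction C with
  | nil => simp [Circuit.eval, Circuit.inv]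
  | cons g C ih =>
    have h : Circuit.inv (g :: C) = Circuit.inv C ++ [g.inv] := by simp [Circuit.inv]
    rw [h, Circuit.eval_append, ih]
    simp [Circuit.eval, Gate.eval_inv]

theorem Circuit.eval_repeat (O : Matrix.unitaryGroup ι ℂ) (C : Circuit ι) (j : ℕ) :
    Circuit.eval O (Circuit.repeat C j) = Circuit.eval O C ^ j := by
  induction j with
  | zero => simp [Circuit.repeat, Circuit.eval]
  | succ j ih =>
    have h : Circuit.repeat C (j + 1) = C ++ Circuit.repeat C j := by
      simp [Circuit.repeat, List.replicate_succ]
    rw [h, Circuit.eval_append, ih, pow_succ]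

theorem Circuit.calls_append (C D : Circuit ι) :
    Circuit.calls (C ++ D) = Circuit.calls C + Circuit.calls D := by
  simp [Circuit.calls]

theorem Circuit.calls_inv (C : Circuit ι) : Circuit.calls (Circuit.inv C) = Circuit.calls C := by
  have h : Gate.calls ∘ Gate.inv = (Gate.calls : Gate ι → ℕ) := by
    funext g
    cases g <;> rfl
  simp [Circuit.calls, Circuit.inv, List.sum_reverse, h]

theorem Circuit.calls_repeat (C : Circuit ι) (j : ℕ) :
    Circuit.calls (Circuit.repeat C j) = j * Circuit.calls C := by
  induction j with
  | zero => simp [Circuit.repeat, Circuit.calls]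
  | succ j ih =>
    have h : Circuit.repeat C (j + 1) = C ++ Circuit.repeat C j := by
      simp [Circuit.repeat, List.replicate_succ]
    rw [h, Circuit.calls_append, ih]
    ring

/-- Each round runs `A` once forwards and once backwards, hence two calls per round on top of the
initial one. -/
theorem calls_append_repeat_amplification (A : Circuit ι) (zero : ι) (good : ι → Prop)
    [DecidablePred good] (hA : Circuit.calls A = 1) (j : ℕ) :
    Circuit.calls (A ++ Circuit.repeat (amplification A zero good) j) = 2 * j + 1 := by
  have h : Circuit.calls (amplification A zero good) = 2 := by
    simp only [amplification, Circuit.calls_append, Circuit.calls_inv, hA]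
    simp [Circuit.calls, Gate.calls]
  rw [Circuit.calls_append, Circuit.calls_repeat, h, hA]
  ring

/-- `A S₀ A⁻¹` is the reflection `v ↦ v - 2 ⟨ψ, v⟩ ψ`, where `ψ = A |0⟩`. -/
theorem conj_signFlip_mulVec (U : Matrix.unitaryGroup ι ℂ) (zero : ι) (v : ι → ℂ) :
    U.1.mulVec ((signFlip (fun i => i = zero)).1.mulVec (U⁻¹.1.mulVec v)) =
      fun b => v b - 2 * (∑ i, star (U.1 i zero) * v i) * U.1 b zero := by
  have h1 : (signFlip (fun i => i = zero)).1.mulVec (U⁻¹.1.mulVec v) =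
      U⁻¹.1.mulVec v - Pi.single zero (2 * (∑ i, star (U.1 i zero) * v i)) := by
    funext i
    simp only [signFlip, diagonalGate, Matrix.mulVec_diagonal, Pi.sub_apply]
    by_cases h : i = zero
    · subst h
      simp [Matrix.mulVec, dotProduct, Matrix.star_apply]
      ring
    · simp [h]
  have h2 : U.1.mulVec (U⁻¹.1.mulVec v) = v := by
    rw [Matrix.mulVec_mulVec]
    have : U.1 * U⁻¹.1 = 1 := by
      exact congrArg Subtype.val (mul_inv_cancel U)
    rw [this, Matrix.one_mulVec]
  rw [h1, Matrix.mulVec_sub, h2]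
  funext b
  simp [Matrix.mulVec_single]
  ring

theorem amplification_mulVec (O : Matrix.unitaryGroup ι ℂ) (A : Circuit ι) (zero : ι)
    (good : ι → Prop) [DecidablePred good] (v : ι → ℂ) :
    (Circuit.eval O (amplification A zero good)).1.mulVec v = fun b =>
      2 * (∑ i, star ((Circuit.eval O A).1 i zero) * ((if good i then -1 else 1) * v i)) *
        (Circuit.eval O A).1 b zero - (if good b then -1 else 1) * v b := by
  have h : Circuit.eval O (amplification A zero good) =
      diagonalGate (fun _ => -1) (fun _ => by simp) * (Circuit.eval O A *
        (signFlip (fun i => i = zero) * ((Circuit.eval O A)⁻¹ * signFlip good))) := by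
    simp [amplification, Circuit.eval, Gate.eval, Circuit.eval_append, Circuit.eval_inv,
      mul_assoc]
  have hs : (signFlip good).1.mulVec v = fun i => (if good i then -1 else 1) * v i := by
    funext i
    simp [signFlip, diagonalGate, Matrix.mulVec_diagonal]
  rw [h]
  simp only [Matrix.UnitaryGroup.mul_val, ← Matrix.mulVec_mulVec]
  rw [hs, conj_signFlip_mulVec]
  funext b
  simp only [diagonalGate, Matrix.mulVec_diagonal]
  ring

/-- The probability that measuring `U |i⟩` gives a state satisfying `P`. -/
def weight (U : Matrix.unitaryGroup ι ℂ) (i : ι) (P : ι → Prop) [DecidablePred P] : ℝ :=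
  ∑ b, if P b then ‖U.1 b i‖ ^ 2 else 0

theorem sum_sq_norm_column_real (U : Matrix.unitaryGroup ι ℂ) (i : ι) :
    ∑ b, ‖U.1 b i‖ ^ 2 = 1 := by
  have h := sum_sq_norm_column U i
  rw [← ENNReal.ofReal_sum_of_nonneg (fun b _ => by positivity)] at h
  simpa using h

theorem weight_add_weight_not (U : Matrix.unitaryGroup ι ℂ) (i : ι) (P : ι → Prop)
    [DecidablePred P] : weight U i P + weight U i (fun b => ¬ P b) = 1 := by
  rw [← sum_sq_norm_column_real U i, weight, weight, ← Finset.sum_add_distrib]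
  refine Finset.sum_congr rfl fun b _ => ?_
  by_cases h : P b <;> simp [h]

/-- The state after `j` rounds of amplitude amplification. -/
theorem exists_amplified_state (O : Matrix.unitaryGroup ι ℂ) (A : Circuit ι) (zero : ι)
    (good : ι → Prop) [DecidablePred good] (θ : ℝ)
    (hθ : weight (Circuit.eval O A) zero good = Real.sin θ ^ 2) (j : ℕ) :
    ∃ α β : ℝ, α * Real.sin θ = Real.sin ((2 * j + 1) * θ) ∧
      β * Real.cos θ = Real.cos ((2 * j + 1) * θ) ∧
      ∀ b, (Circuit.eval O (A ++ Circuit.repeat (amplification A zero good) j)).1 b zero =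
        (if good b then (α : ℂ) else β) * (Circuit.eval O A).1 b zero := by
  have hnot : weight (Circuit.eval O A) zero (fun b => ¬ good b) = Real.cos θ ^ 2 := by
    have h1 := weight_add_weight_not (Circuit.eval O A) zero good
    have h2 := Real.sin_sq_add_cos_sq θ
    linarith
  induction j with
  | zero => exact ⟨1, 1, by simp, by simp, fun b => by simp [Circuit.repeat]⟩
  | succ j ih =>
    obtain ⟨α, β, hα, hβ, hv⟩ := ih
    -- These are the addition formulas for the increment `2θ` with `sin θ` and `cos θ` divided out,
    -- so nothing breaks when one of them vanishes.
    refine ⟨(1 - 2 * Real.sin θ ^ 2) * α + 2 * Real.cos θ ^ 2 * β,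
      (2 * Real.cos θ ^ 2 - 1) * β - 2 * Real.sin θ ^ 2 * α, ?_, ?_, ?_⟩
    · rw [show ((2 * ((j + 1 : ℕ) : ℝ) + 1) * θ) = (2 * j + 1) * θ + 2 * θ by push_cast; ring,
        Real.sin_add, ← hα, ← hβ, Real.sin_two_mul, Real.cos_two_mul]
      linear_combination (-2 * α * Real.sin θ) * Real.sin_sq_add_cos_sq θ
    · rw [show ((2 * ((j + 1 : ℕ) : ℝ) + 1) * θ) = (2 * j + 1) * θ + 2 * θ by push_cast; ring,
        Real.cos_add, ← hα, ← hβ, Real.sin_two_mul, Real.cos_two_mul]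
      ring
    · intro b
      have hcol : ∀ k, (fun b => (Circuit.eval O
          (A ++ Circuit.repeat (amplification A zero good) k)).1 b zero) =
          ((Circuit.eval O (amplification A zero good) ^ k * Circuit.eval O A)).1.mulVec
            (Pi.single zero 1) := by
        intro k
        rw [Circuit.eval_append, Circuit.eval_repeat]
        funext b
        simp
      -- The inner product of `A |0⟩` with the sign-flipped state is real, because both parts are
      -- real multiples of the corresponding parts of `A |0⟩`.
      have hsum : (∑ i, star ((Circuit.eval O A).1 i zero) * ((if good i then -1 else 1) *
          ((if good i then (α : ℂ) else β) * (Circuit.eval O A).1 i zero))) =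
          ((β * Real.cos θ ^ 2 - α * Real.sin θ ^ 2 : ℝ) : ℂ) := by
        rw [← hθ, ← hnot, weight, weight, Finset.mul_sum, Finset.mul_sum,
          ← Finset.sum_sub_distrib, Complex.ofReal_sum]
        refine Finset.sum_congr rfl fun i _ => ?_
        have hi : star ((Circuit.eval O A).1 i zero) * (Circuit.eval O A).1 i zero =
            ((‖(Circuit.eval O A).1 i zero‖ ^ 2 : ℝ) : ℂ) := by
          rw [Complex.star_def, Complex.conj_mul']
          push_cast
          rfl
        by_cases h : good i
        · simp only [h, if_true, not_true, if_false, mul_zero, zero_sub]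
          rw [Complex.ofReal_neg, Complex.ofReal_mul, ← hi]
          ring
        · simp only [h, not_false_iff, if_true, if_false, mul_zero, sub_zero]
          rw [Complex.ofReal_mul, ← hi]
          ring
      have := congrFun (hcol (j + 1)) b
      rw [this, pow_succ', mul_assoc, Matrix.UnitaryGroup.mul_val, ← Matrix.mulVec_mulVec,
        ← hcol j, funext hv, amplification_mulVec]
      simp only []
      rw [hsum]
      by_cases h : good b
      · simp only [h, if_true]
        push_cast
        ring
      · simp only [h, if_false]
        push_cast
        ring

theorem weight_amplified (O : Matrix.unitaryGroup ι ℂ) (A : Circuit ι) (zero : ι)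
    (good : ι → Prop) [DecidablePred good] (θ : ℝ)
    (hθ : weight (Circuit.eval O A) zero good = Real.sin θ ^ 2) (j : ℕ) :
    weight (Circuit.eval O (A ++ Circuit.repeat (amplification A zero good) j)) zero good =
      Real.sin ((2 * j + 1) * θ) ^ 2 := by
  obtain ⟨α, β, hα, -, hv⟩ := exists_amplified_state O A zero good θ hθ j
  rw [← hα, mul_pow, ← hθ, weight, weight, Finset.mul_sum]
  refine Finset.sum_congr rfl fun b _ => ?_
  by_cases h : good b
  · simp [h, hv, mul_pow]
  · simp [h]

/-- Amplification only rescales the two parts of `A |0⟩`, so it creates no new basis states. This is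
why any returned state encodes a point of `X`. -/
theorem amplified_apply_eq_zero (O : Matrix.unitaryGroup ι ℂ) (A : Circuit ι) (zero : ι)
    (good : ι → Prop) [DecidablePred good] (j : ℕ) (b : ι)
    (hb : (Circuit.eval O A).1 b zero = 0) :
    (Circuit.eval O (A ++ Circuit.repeat (amplification A zero good) j)).1 b zero = 0 := by
  have h0 : 0 ≤ weight (Circuit.eval O A) zero good :=
    Finset.sum_nonneg fun b _ => by split_ifs <;> positivity
  have h0' : 0 ≤ weight (Circuit.eval O A) zero (fun b => ¬ good b) :=
    Finset.sum_nonneg fun b _ => by split_ifs <;> positivity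
  have h1 := weight_add_weight_not (Circuit.eval O A) zero good
  obtain ⟨α, β, -, -, hv⟩ := exists_amplified_state O A zero good
    (Real.arcsin (Real.sqrt (weight (Circuit.eval O A) zero good))) (by
      rw [Real.sin_arcsin, Real.sq_sqrt h0]
      · linarith [Real.sqrt_nonneg (weight (Circuit.eval O A) zero good)]
      · exact Real.sqrt_le_one.2 (by linarith)) j
  rw [hv, hb, mul_zero]

end Circuits

/-! ## Expectations and potentials of modified QSearch -/

section Expectation

/-- The expectation of a nonnegative function. -/
def expect {α : Type} (ρ : PMF α) (φ : α → ℝ≥0∞) : ℝ≥0∞ := ∑' x, ρ x * φ x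

theorem expect_pure {α : Type} (a : α) (φ : α → ℝ≥0∞) : expect (PMF.pure a) φ = φ a := by
  classical
  rw [expect, tsum_eq_single a]
  · simp
  · intro b hb
    simp [PMF.pure_apply, hb]

theorem expect_bind {α β : Type} (ρ : PMF α) (g : α → PMF β) (φ : β → ℝ≥0∞) :
    expect (ρ.bind g) φ = expect ρ fun a => expect (g a) φ := by
  simp only [expect, PMF.bind_apply, ← ENNReal.tsum_mul_right, ← ENNReal.tsum_mul_left]
  rw [ENNReal.tsum_comm]
  simp only [mul_assoc]

theorem expect_mono {α : Type} (ρ : PMF α) {φ ψ : α → ℝ≥0∞} (h : ∀ a ∈ ρ.support, φ a ≤ ψ a) :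
    expect ρ φ ≤ expect ρ ψ := by
  refine ENNReal.tsum_le_tsum fun a => ?_
  by_cases ha : ρ a = 0
  · simp [ha]
  · exact mul_le_mul_right (h a ((PMF.mem_support_iff _ _).2 ha)) _

theorem expect_add {α : Type} (ρ : PMF α) (φ ψ : α → ℝ≥0∞) :
    expect ρ (fun a => φ a + ψ a) = expect ρ φ + expect ρ ψ := by
  simp only [expect, mul_add, ENNReal.tsum_add]

theorem expect_const {α : Type} (ρ : PMF α) (r : ℝ≥0∞) : expect ρ (fun _ => r) = r := by
  rw [expect, ENNReal.tsum_mul_right, PMF.tsum_coe, one_mul]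

theorem expect_const_mul {α : Type} (ρ : PMF α) (r : ℝ≥0∞) (φ : α → ℝ≥0∞) :
    expect ρ (fun a => r * φ a) = r * expect ρ φ := by
  rw [expect, expect, ← ENNReal.tsum_mul_left]
  exact tsum_congr fun a => by ring

open Classical in
theorem prob_eq_expect {α : Type} (ρ : PMF α) (E : α → Prop) :
    prob ρ E = expect ρ fun a => if E a then 1 else 0 := by
  rw [prob, PMF.toOuterMeasure_apply, expect]
  refine tsum_congr fun a => ?_
  by_cases h : E a <;> simp [Set.indicator, h]

theorem prob_le_one {α : Type} (ρ : PMF α) (E : α → Prop) : prob ρ E ≤ 1 := by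
  classical
  rw [prob_eq_expect]
  refine (expect_mono ρ fun a _ => ?_).trans_eq (expect_const ρ 1)
  split_ifs
  · exact le_rfl
  · exact zero_le_one

theorem expect_uniformOfFinset {α : Type} (s : Finset α) (hs : s.Nonempty) (g : α → ℝ)
    (hg : ∀ a ∈ s, 0 ≤ g a) :
    expect (PMF.uniformOfFinset s hs) (fun a => ENNReal.ofReal (g a)) =
      ENNReal.ofReal ((∑ a ∈ s, g a) / s.card) := by
  classical
  have hc : (0 : ℝ) < s.card := by exact_mod_cast hs.card_pos
  rw [expect, tsum_eq_sum (s := s)]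
  · rw [Finset.sum_div, ENNReal.ofReal_sum_of_nonneg fun a ha => div_nonneg (hg a ha) hc.le]
    refine Finset.sum_congr rfl fun a ha => ?_
    rw [PMF.uniformOfFinset_apply_of_mem hs ha, ENNReal.ofReal_div_of_pos hc,
      ENNReal.ofReal_natCast, mul_comm, div_eq_mul_inv]
  · intro a ha
    rw [PMF.uniformOfFinset_apply_of_notMem hs ha, zero_mul]

theorem expect_measure_ite {ι : Type} [Fintype ι] [DecidableEq ι]
    (U : Matrix.unitaryGroup ι ℂ) (i : ι) (P : ι → Prop) [DecidablePred P] {x y : ℝ}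
    (hx : 0 ≤ x) (hy : 0 ≤ y) :
    expect (measure U i) (fun b => if P b then ENNReal.ofReal x else ENNReal.ofReal y) =
      ENNReal.ofReal (weight U i P * x + (1 - weight U i P) * y) := by
  rw [← weight_add_weight_not U i P, add_sub_cancel_left, weight, weight, Finset.sum_mul,
    Finset.sum_mul, ← Finset.sum_add_distrib, expect, tsum_fintype,
    ENNReal.ofReal_sum_of_nonneg]
  · refine Finset.sum_congr rfl fun b _ => ?_
    by_cases h : P b
    · simp only [h, if_true, not_true, if_false, zero_mul, add_zero]
      rw [ENNReal.ofReal_mul (by positivity), measure, PMF.ofFintype_apply]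
    · simp only [h, if_false, not_false_iff, if_true, zero_mul, zero_add]
      rw [ENNReal.ofReal_mul (by positivity), measure, PMF.ofFintype_apply]
  · intro b _
    by_cases h : P b <;> simp only [h, if_true, if_false, not_true, not_false_iff] <;> positivity

end Expectation

/-! ### Supermartingale bounds from potentials. -/

section Potential

/-- The function on the states of the search with the given values, depending on the counters
`l`, `u` and on the number of oracle calls. -/
def potential {ι : Type} (v₀ : ℝ) (vloop : ℕ → ℕ → ℕ → ℝ) (vfound vfailed : ℕ → ℝ) :
    SearchState ι → ℝ≥0∞
  | .start => ENNReal.ofReal v₀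
  | .loop l u m => ENNReal.ofReal (vloop l u m)
  | .found _ m => ENNReal.ofReal (vfound m)
  | .failed m => ENNReal.ofReal (vfailed m)

/-- The mean over `j = 1, …, M`. -/
def mean (M : ℕ) (g : ℕ → ℝ) : ℝ := (∑ j ∈ Finset.Icc 1 M, g j) / M

/-- The counter `u` after the iteration that increases `l` from `l - 1` to `l`. -/
def nextCount (N : ℕ) (c : ℝ) (l u : ℕ) : ℕ := if Real.sqrt N < ⌈c ^ l⌉₊ then u + 1 else u

/-- The expected value of a potential after an iteration of the loop. -/
def loopMean (θ : ℝ) (N : ℕ) (c : ℝ) (vloop : ℕ → ℕ → ℕ → ℝ) (vfound : ℕ → ℝ) (l u m : ℕ) : ℝ :=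
  mean ⌈c ^ (l + 1)⌉₊ fun j =>
    Real.sin ((2 * j + 1) * θ) ^ 2 * vfound (m + (2 * j + 1)) +
      Real.cos ((2 * j + 1) * θ) ^ 2 *
        vloop (l + 1) (nextCount N c (l + 1) u) (m + (2 * j + 1))

variable {ι : Type} [Fintype ι] [DecidableEq ι] (O : Matrix.unitaryGroup ι ℂ)
    (A : Circuit ι) (zero : ι) (good : ι → Prop) [DecidablePred good] (N : ℕ) (τ c : ℝ)
    (hc : 1 < c) (θ : ℝ)

theorem expect_searchStep_start (hA : Circuit.calls A = 1)
    (hθ : weight (Circuit.eval O A) zero good = Real.sin θ ^ 2)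
    (v₀ : ℝ) (vloop : ℕ → ℕ → ℕ → ℝ) (vfound vfailed : ℕ → ℝ)
    (hl : ∀ l u m, 0 ≤ vloop l u m) (hf : ∀ m, 0 ≤ vfound m) :
    expect (searchStep O A zero good N τ c hc .start) (potential v₀ vloop vfound vfailed) =
      ENNReal.ofReal (Real.sin θ ^ 2 * vfound 1 + Real.cos θ ^ 2 * vloop 0 0 1) := by
  rw [searchStep, expect_bind, Real.cos_sq', ← hθ, ← expect_measure_ite _ _ _ (hf 1) (hl 0 0 1)]
  congr 1
  funext b
  rw [expect_pure, hA]
  split_ifs <;> rfl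

/-- A potential ignores which basis state is found, so only the success probability of each `j`
enters. -/
theorem expect_searchStep_loop (hA : Circuit.calls A = 1)
    (hθ : weight (Circuit.eval O A) zero good = Real.sin θ ^ 2)
    (v₀ : ℝ) (vloop : ℕ → ℕ → ℕ → ℝ) (vfound vfailed : ℕ → ℝ)
    (hl : ∀ l u m, 0 ≤ vloop l u m) (hf : ∀ m, 0 ≤ vfound m) (l u m : ℕ)
    (hu : (u : ℝ) < Real.log τ / Real.log (3 / 4)) :
    expect (searchStep O A zero good N τ c hc (.loop l u m))
        (potential v₀ vloop vfound vfailed) =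
      ENNReal.ofReal (loopMean θ N c vloop vfound l u m) := by
  have h : loopMean θ N c vloop vfound l u m = (∑ j ∈ Finset.Icc 1 ⌈c ^ (l + 1)⌉₊,
      (Real.sin ((2 * j + 1) * θ) ^ 2 * vfound (m + (2 * j + 1)) +
      Real.cos ((2 * j + 1) * θ) ^ 2 *
        vloop (l + 1) (nextCount N c (l + 1) u) (m + (2 * j + 1)))) /
        (Finset.Icc 1 ⌈c ^ (l + 1)⌉₊).card := by
    simp [loopMean, mean]
  rw [searchStep, if_pos hu, expect_bind, h,
    ← expect_uniformOfFinset _ (Icc_ceil_nonempty hc (l + 1))]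
  · congr 1
    funext j
    rw [expect_bind, Real.cos_sq', ← weight_amplified O A zero good θ hθ j,
      ← expect_measure_ite _ _ _ (hf _) (hl _ _ _)]
    congr 1
    funext b
    rw [expect_pure, calls_append_repeat_amplification A zero good hA]
    by_cases h : good b
    · simp [h, potential]
    · simp only [h, if_false, nextCount, potential]
  · intro j _
    exact add_nonneg (mul_nonneg (sq_nonneg _) (hf _)) (mul_nonneg (sq_nonneg _) (hl _ _ _))

theorem expect_modifiedQSearch_succ (φ : SearchState ι → ℝ≥0∞) (k : ℕ) :
    expect (modifiedQSearch O A zero good N τ c hc (k + 1)) φ =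
      expect (modifiedQSearch O A zero good N τ c hc k)
        fun σ => expect (searchStep O A zero good N τ c hc σ) φ := by
  rw [modifiedQSearch, expect_bind]

/-- A potential that does not increase in expectation bounds its expectation at all times. -/
theorem expect_potential_le (hA : Circuit.calls A = 1)
    (hθ : weight (Circuit.eval O A) zero good = Real.sin θ ^ 2)
    (v₀ : ℝ) (vloop : ℕ → ℕ → ℕ → ℝ) (vfound vfailed : ℕ → ℝ)
    (hl : ∀ l u m, 0 ≤ vloop l u m) (hf : ∀ m, 0 ≤ vfound m)
    (hstart : Real.sin θ ^ 2 * vfound 1 + Real.cos θ ^ 2 * vloop 0 0 1 ≤ v₀)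
    (hloop : ∀ l u m : ℕ, (u : ℝ) < Real.log τ / Real.log (3 / 4) →
      loopMean θ N c vloop vfound l u m ≤ vloop l u m)
    (hexit : ∀ l u m : ℕ, Real.log τ / Real.log (3 / 4) ≤ (u : ℝ) → vfailed m ≤ vloop l u m) (k : ℕ) :
    expect (modifiedQSearch O A zero good N τ c hc k) (potential v₀ vloop vfound vfailed) ≤
      ENNReal.ofReal v₀ := by
  induction k with
  | zero => rw [modifiedQSearch, expect_pure]; rfl
  | succ k ih =>
    rw [expect_modifiedQSearch_succ]
    refine le_trans (expect_mono _ fun σ _ => ?_) ih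
    cases σ with
    | start =>
      rw [expect_searchStep_start O A zero good N τ c hc θ hA hθ v₀ _ _ _ hl hf]
      exact ENNReal.ofReal_le_ofReal hstart
    | loop l u m =>
      by_cases hu : (u : ℝ) < Real.log τ / Real.log (3 / 4)
      · rw [expect_searchStep_loop O A zero good N τ c hc θ hA hθ v₀ _ _ _ hl hf l u m hu]
        exact ENNReal.ofReal_le_ofReal (hloop l u m hu)
      · rw [searchStep, if_neg hu, expect_pure]
        exact ENNReal.ofReal_le_ofReal (hexit l u m (not_lt.1 hu))
    | found b m => rw [searchStep, expect_pure]
    | failed m => rw [searchStep, expect_pure]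

end Potential

/-! ## Termination -/

section Termination

variable {ι : Type} [Fintype ι] [DecidableEq ι] (O : Matrix.unitaryGroup ι ℂ)
    (A : Circuit ι) (zero : ι) (good : ι → Prop) [DecidablePred good] (N : ℕ) (τ c : ℝ)
    (hc : 1 < c)

theorem mem_support_measure {U : Matrix.unitaryGroup ι ℂ} {i b : ι}
    (hb : b ∈ (measure U i).support) : U.1 b i ≠ 0 := by
  intro h
  rw [PMF.mem_support_iff, measure, PMF.ofFintype_apply] at hb
  simp [h] at hb

/-- After `k` steps the search has found a desired state in the support of `A |0⟩`, has failed, or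
is in the loop with `l = k - 1` and a counter `u` that is increased in all but the first `L`
iterations. -/
theorem modifiedQSearch_support (L : ℕ) (hL : ∀ l, L < l → Real.sqrt N < ⌈c ^ l⌉₊) (k : ℕ)
    (σ : SearchState ι) (hσ : σ ∈ (modifiedQSearch O A zero good N τ c hc k).support) :
    (∃ b m, σ = .found b m ∧ good b ∧ (Circuit.eval O A).1 b zero ≠ 0) ∨
      (∃ m, σ = .failed m) ∨ (k = 0 ∧ σ = .start) ∨
      ∃ l u m, σ = .loop l u m ∧ k = l + 1 ∧ l ≤ u + L ∧
        u ≤ ⌈Real.log τ / Real.log (3 / 4)⌉₊ := by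
  induction k generalizing σ with
  | zero =>
    right; right; left
    simpa [modifiedQSearch] using hσ
  | succ k ih =>
    rw [modifiedQSearch, PMF.mem_support_bind_iff] at hσ
    obtain ⟨σ', hσ', hs⟩ := hσ
    rcases ih σ' hσ' with ⟨b, m, rfl, hb⟩ | ⟨m, rfl⟩ | ⟨rfl, rfl⟩ | ⟨l, u, m, rfl, rfl, hl, hu⟩
    · rw [searchStep, PMF.mem_support_pure_iff] at hs
      exact Or.inl ⟨b, m, hs, hb⟩
    · rw [searchStep, PMF.mem_support_pure_iff] at hs
      exact Or.inr (Or.inl ⟨m, hs⟩)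
    · rw [searchStep, PMF.mem_support_bind_iff] at hs
      obtain ⟨b, hb, hs⟩ := hs
      rw [PMF.mem_support_pure_iff] at hs
      split_ifs at hs with hg
      · exact Or.inl ⟨b, _, hs, hg, mem_support_measure hb⟩
      · exact Or.inr (Or.inr (Or.inr ⟨0, 0, _, hs, rfl, Nat.zero_le _, Nat.zero_le _⟩))
    · by_cases hlt : (u : ℝ) < Real.log τ / Real.log (3 / 4)
      · rw [searchStep, if_pos hlt, PMF.mem_support_bind_iff] at hs
        obtain ⟨j, -, hs⟩ := hs
        rw [PMF.mem_support_bind_iff] at hs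
        obtain ⟨b, hb, hs⟩ := hs
        rw [PMF.mem_support_pure_iff] at hs
        have hlt' : u < ⌈Real.log τ / Real.log (3 / 4)⌉₊ := Nat.lt_ceil.2 hlt
        split_ifs at hs with hg h
        · refine Or.inl ⟨b, _, hs, hg, fun h0 => mem_support_measure hb ?_⟩
          exact amplified_apply_eq_zero O A zero good j b h0
        · exact Or.inr (Or.inr (Or.inr ⟨l + 1, u + 1, _, hs, rfl, by omega, by omega⟩))
        · refine Or.inr (Or.inr (Or.inr ⟨l + 1, u, _, hs, rfl, ?_, by omega⟩))
          have : ¬ L < l + 1 := fun h' => h (hL _ h')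
          omega
      · rw [searchStep, if_neg hlt, PMF.mem_support_pure_iff] at hs
        exact Or.inr (Or.inl ⟨m, hs⟩)

theorem modifiedQSearch_halts : ∃ K : ℕ, ∀ k ≥ K,
    ∀ σ ∈ (modifiedQSearch O A zero good N τ c hc k).support,
      (∃ b m, σ = .found b m ∧ good b ∧ (Circuit.eval O A).1 b zero ≠ 0) ∨
        ∃ m, σ = .failed m := by
  obtain ⟨L, hL⟩ := pow_unbounded_of_one_lt (Real.sqrt N) hc
  have hL' : ∀ l, L < l → Real.sqrt N < ⌈c ^ l⌉₊ := fun l hl =>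
    hL.trans_le ((pow_le_pow_right₀ hc.le hl.le).trans (Nat.le_ceil _))
  -- A looping execution has `k = l + 1 ≤ u + L + 1` with `u` at most the ceiling; one more step
  -- excludes it.
  refine ⟨⌈Real.log τ / Real.log (3 / 4)⌉₊ + L + 2, fun k hk σ hσ => ?_⟩
  rcases modifiedQSearch_support O A zero good N τ c hc L hL' k σ hσ with
    h | h | ⟨h, -⟩ | ⟨l, u, m, -, h1, h2, h3⟩
  · exact Or.inl h
  · exact Or.inr h
  · omega
  · omega

end Termination

/-! ## The mean failure probability of an iteration -/

section Means

theorem mean_const {M : ℕ} (hM : 0 < M) (r : ℝ) : mean M (fun _ => r) = r := by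
  have : (M : ℝ) ≠ 0 := by positivity
  simp [mean, this]

theorem mean_add (M : ℕ) (g h : ℕ → ℝ) :
    mean M (fun j => g j + h j) = mean M g + mean M h := by
  rw [mean, mean, mean, Finset.sum_add_distrib, add_div]

theorem mean_mul_const (M : ℕ) (g : ℕ → ℝ) (r : ℝ) :
    mean M (fun j => g j * r) = mean M g * r := by
  rw [mean, mean, ← Finset.sum_mul, div_mul_eq_mul_div]

theorem mean_le_mean {M : ℕ} {g h : ℕ → ℝ} (hgh : ∀ j, 1 ≤ j → j ≤ M → g j ≤ h j) :
    mean M g ≤ mean M h := by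
  refine div_le_div_of_nonneg_right (Finset.sum_le_sum fun j hj => ?_) (Nat.cast_nonneg M)
  exact hgh j (Finset.mem_Icc.1 hj).1 (Finset.mem_Icc.1 hj).2

theorem mean_nonneg {M : ℕ} {g : ℕ → ℝ} (hg : ∀ j, 0 ≤ g j) : 0 ≤ mean M g :=
  div_nonneg (Finset.sum_nonneg fun j _ => hg j) (Nat.cast_nonneg M)

/-- The probability that an iteration of the loop with `j` drawn from `1, …, M` finds nothing. -/
def failMean (θ : ℝ) (M : ℕ) : ℝ := mean M fun j => Real.cos ((2 * j + 1) * θ) ^ 2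

theorem failMean_nonneg (θ : ℝ) (M : ℕ) : 0 ≤ failMean θ M := mean_nonneg fun _ => sq_nonneg _

theorem failMean_le_one (θ : ℝ) {M : ℕ} (hM : 0 < M) : failMean θ M ≤ 1 := by
  rw [← mean_const hM 1]
  exact mean_le_mean fun j _ _ => Real.cos_sq_le_one _

/-- Each rotation by `2θ` adds at most `|sin 2θ| ≤ 2 |sin θ|`. This limits how fast amplification
can work and drives the lower bound. -/
theorem abs_sin_odd_mul_le (θ : ℝ) (j : ℕ) :
    |Real.sin ((2 * j + 1) * θ)| ≤ (2 * j + 1) * |Real.sin θ| := by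
  induction j with
  | zero => simp
  | succ j ih =>
    rw [show ((2 * ((j + 1 : ℕ) : ℝ) + 1) * θ) = (2 * j + 1) * θ + 2 * θ by push_cast; ring,
      Real.sin_add, Real.sin_two_mul]
    have h1 : |Real.sin ((2 * j + 1) * θ) * Real.cos (2 * θ)| ≤ |Real.sin ((2 * j + 1) * θ)| := by
      rw [abs_mul]
      exact mul_le_of_le_one_right (abs_nonneg _) (Real.abs_cos_le_one _)
    have h2 : |Real.cos ((2 * j + 1) * θ) * (2 * Real.sin θ * Real.cos θ)| ≤
        2 * |Real.sin θ| := by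
      rw [abs_mul, abs_mul, abs_mul, abs_two]
      have h3 := Real.abs_cos_le_one ((2 * j + 1) * θ)
      have h4 := Real.abs_cos_le_one θ
      calc _ ≤ 1 * (2 * |Real.sin θ| * 1) := by gcongr
        _ = _ := by ring
    have := abs_add_le (Real.sin ((2 * j + 1) * θ) * Real.cos (2 * θ))
      (Real.cos ((2 * j + 1) * θ) * (2 * Real.sin θ * Real.cos θ))
    push_cast
    linarith

theorem cos_odd_mul_eq_zero {θ : ℝ} (h : Real.cos θ = 0) (j : ℕ) :
    Real.cos ((2 * j + 1) * θ) = 0 := by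
  induction j with
  | zero => simpa using h
  | succ j ih =>
    rw [show ((2 * ((j + 1 : ℕ) : ℝ) + 1) * θ) = (2 * j + 1) * θ + 2 * θ by push_cast; ring,
      Real.cos_add, Real.sin_two_mul, ih, h]
    ring

theorem failMean_eq_zero {θ : ℝ} (h : Real.cos θ = 0) (M : ℕ) : failMean θ M = 0 := by
  simp [failMean, cos_odd_mul_eq_zero h, mean]

/-- The sum telescopes after multiplication by `sin 2θ`; keeping that factor avoids a division. The
last term is `- sin 4θ`, the lower boundary term of a sum that starts at `j = 1` rather than `0`. -/
theorem sum_cos_sq_mul (θ : ℝ) (M : ℕ) :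
    (∑ j ∈ Finset.Icc 1 M, Real.cos ((2 * j + 1) * θ) ^ 2) * (4 * Real.sin (2 * θ)) =
      2 * M * Real.sin (2 * θ) + Real.sin (4 * (M + 1) * θ) -
        2 * Real.sin (2 * θ) * Real.cos (2 * θ) := by
  induction M with
  | zero =>
    have := Real.sin_two_mul (2 * θ)
    rw [show 2 * (2 * θ) = 4 * (((0 : ℕ) : ℝ) + 1) * θ by push_cast; ring] at this
    rw [this]
    simp
  | succ M ih =>
    rw [Finset.sum_Icc_succ_top (by omega), add_mul, ih]
    have h1 : 4 * (((M + 1 : ℕ) : ℝ) + 1) * θ = 2 * ((2 * ((M + 1 : ℕ) : ℝ) + 1) * θ) + 2 * θ := by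
      ring
    have h2 : 4 * ((M : ℝ) + 1) * θ = 2 * ((2 * ((M + 1 : ℕ) : ℝ) + 1) * θ) - 2 * θ := by
      push_cast
      ring
    rw [h1, h2, Real.sin_add, Real.sin_sub, Real.cos_two_mul ((2 * ((M + 1 : ℕ) : ℝ) + 1) * θ)]
    push_cast
    ring

theorem failMean_mul (θ : ℝ) {M : ℕ} (hM : 0 < M) :
    failMean θ M * (4 * M * Real.sin (2 * θ)) =
      2 * M * Real.sin (2 * θ) + Real.sin (4 * (M + 1) * θ) -
        2 * Real.sin (2 * θ) * Real.cos (2 * θ) := by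
  rw [← sum_cos_sq_mul, failMean, mean]
  have : (M : ℝ) ≠ 0 := by positivity
  rw [div_mul_eq_mul_div, div_eq_iff this]
  ring

/-- When `M` is large compared with `1 / sin 2θ`, an iteration fails with probability not much
above one half. -/
theorem failMean_le_half_add {θ r : ℝ} {M : ℕ} (hM : 0 < M) (hr : 0 < r)
    (h : r ≤ M * Real.sin (2 * θ)) : failMean θ M ≤ 1 / 2 + 3 / (4 * r) := by
  have hpos : 0 < M * Real.sin (2 * θ) := hr.trans_le h
  have hS : 0 < Real.sin (2 * θ) := pos_of_mul_pos_right hpos (Nat.cast_nonneg M)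
  have h1 := failMean_mul θ hM
  have h2 := Real.sin_le_one (4 * (M + 1) * θ)
  have h3 := Real.neg_one_le_cos (2 * θ)
  have h4 := Real.sin_le_one (2 * θ)
  have h5 : failMean θ M * (4 * (M * Real.sin (2 * θ))) ≤ 2 * (M * Real.sin (2 * θ)) + 3 := by
    nlinarith
  have h6 : failMean θ M ≤ 1 / 2 + 3 / (4 * (M * Real.sin (2 * θ))) := by
    rw [← le_div_iff₀ (by positivity)] at h5
    refine h5.trans (le_of_eq ?_)
    field_simp
    ring
  refine h6.trans ?_
  gcongr

/-- Polynomials in `cos² θ`, for the two small cases below that are evaluated exactly. -/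
theorem cos_odd_sq_eq (θ : ℝ) :
    Real.cos (3 * θ) ^ 2 = Real.cos θ ^ 2 * (4 * Real.cos θ ^ 2 - 3) ^ 2 ∧
    Real.cos (5 * θ) ^ 2 =
      Real.cos θ ^ 2 * (16 * (Real.cos θ ^ 2) ^ 2 - 20 * Real.cos θ ^ 2 + 5) ^ 2 ∧
    Real.cos (7 * θ) ^ 2 = Real.cos θ ^ 2 *
      (64 * (Real.cos θ ^ 2) ^ 3 - 112 * (Real.cos θ ^ 2) ^ 2 + 56 * Real.cos θ ^ 2 - 7) ^ 2 := by
  have hrec : ∀ u, Real.cos (u + 2 * θ) = 2 * (2 * Real.cos θ ^ 2 - 1) * Real.cos u -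
      Real.cos (u - 2 * θ) := by
    intro u
    rw [Real.cos_add, Real.cos_sub, Real.cos_two_mul]
    ring
  have h3 := Real.cos_three_mul θ
  have h5 := hrec (3 * θ)
  rw [show 3 * θ + 2 * θ = 5 * θ by ring, show 3 * θ - 2 * θ = θ by ring, h3] at h5
  have h7 := hrec (5 * θ)
  rw [show 5 * θ + 2 * θ = 7 * θ by ring, show 5 * θ - 2 * θ = 3 * θ by ring, h3, h5] at h7
  rw [h3, h5, h7]
  refine ⟨by ring, by ring, by ring⟩

/-- By `failMean_mul`, the bound `3/4` means `sin (4(M+1)θ) ≤ sin 2θ (M + 2 cos 2θ)`, so it is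
enough that the right side is at least `1`. With `x = cos² θ` one has `sin² 2θ = 4x(1-x)` and `cos
2θ = 2x - 1`; `p` and `q` bound the two factors from below. -/
theorem failMean_le_three_quarters_of_le {θ p q : ℝ} {M : ℕ} (hM : 0 < M)
    (hS : 0 < Real.sin (2 * θ)) (hp : 0 ≤ p) (hpx : p ≤ Real.cos θ ^ 2 * (1 - Real.cos θ ^ 2))
    (hq : 0 < q) (hqx : q ≤ M + 2 * (2 * Real.cos θ ^ 2 - 1)) (h : 1 ≤ 4 * p * q ^ 2) :
    failMean θ M ≤ 3 / 4 := by
  have hMr : (0 : ℝ) < M := by exact_mod_cast hM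
  have hSsq : Real.sin (2 * θ) ^ 2 = 4 * (Real.cos θ ^ 2 * (1 - Real.cos θ ^ 2)) := by
    rw [Real.sin_two_mul, ← Real.sin_sq]
    ring
  have h1 : 1 ≤ Real.sin (2 * θ) ^ 2 * (M + 2 * (2 * Real.cos θ ^ 2 - 1)) ^ 2 := by
    rw [hSsq]
    exact h.trans (mul_le_mul (by linarith) (by gcongr) (sq_nonneg _) (by linarith))
  rw [← mul_pow, one_le_sq_iff₀ (mul_nonneg hS.le (by linarith)), ← Real.cos_two_mul] at h1
  have h2 := failMean_mul θ hM
  have h3 := Real.sin_le_one (4 * (M + 1) * θ)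
  have h4 : failMean θ M * (4 * M * Real.sin (2 * θ)) ≤
      3 / 4 * (4 * M * Real.sin (2 * θ)) := by
    rw [h2]
    linarith
  exact le_of_mul_le_mul_right h4 (by positivity)

theorem mul_one_sub_le_mul_one_sub {a x : ℝ} (h1 : a ≤ x) (h2 : x ≤ 1 - a) :
    a * (1 - a) ≤ x * (1 - x) := by
  nlinarith [mul_nonneg (sub_nonneg.2 h1) (sub_nonneg.2 h2)]

/-- An iteration with `M > √N` fails with probability at most `3/4`. -/
theorem failMean_le_three_quarters {θ : ℝ} {N t M : ℕ} (ht : 0 < t) (htN : t ≤ N)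
    (hMN : N < M ^ 2) (h0 : 0 ≤ θ) (h1 : θ ≤ Real.pi / 2)
    (hθ : Real.sin θ ^ 2 = t / N) : failMean θ M ≤ 3 / 4 := by
  have hM : 0 < M := by
    rcases Nat.eq_zero_or_pos M with rfl | h
    · simp at hMN
    · exact h
  have hN : 0 < N := by omega
  have hNr : (0 : ℝ) < N := by exact_mod_cast hN
  obtain ⟨r, rfl⟩ := Nat.exists_eq_add_of_le htN
  have hx : Real.cos θ ^ 2 = r / (t + r : ℕ) := by
    rw [Real.cos_sq', hθ]
    field_simp
    push_cast
    ring
  rcases Nat.eq_zero_or_pos r with rfl | hr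
  · rw [failMean_eq_zero (by simpa using hx)]
    norm_num
  have hs : 0 < Real.sin θ := by
    refine lt_of_le_of_ne (Real.sin_nonneg_of_nonneg_of_le_pi h0 (by linarith [Real.pi_pos])) ?_
    intro h
    rw [← h] at hθ
    have : (0 : ℝ) < t / (t + r : ℕ) := by positivity
    rw [← hθ] at this
    norm_num at this
  have hc : 0 < Real.cos θ := by
    refine lt_of_le_of_ne (Real.cos_nonneg_of_neg_pi_div_two_le_of_le
      (by linarith [Real.pi_pos]) h1) ?_
    intro h
    rw [← h] at hx
    have : (0 : ℝ) < r / (t + r : ℕ) := by positivity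
    rw [← hx] at this
    norm_num at this
  have hS : 0 < Real.sin (2 * θ) := by
    rw [Real.sin_two_mul]
    positivity
  set x := Real.cos θ ^ 2 with hxdef
  have hMr : (0 : ℝ) < M := by exact_mod_cast hM
  have hkey3 : ∀ p q : ℝ, 0 ≤ p → p ≤ x * (1 - x) → 0 < q → q ≤ M + 2 * (2 * x - 1) →
      1 ≤ 4 * p * q ^ 2 → failMean θ M ≤ 3 / 4 := fun p q =>
    failMean_le_three_quarters_of_le hM hS
  have hMsq : ((t + r : ℕ) : ℝ) + 1 ≤ M ^ 2 := by exact_mod_cast hMN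
  -- This is `(t - 1)(r - 1) ≥ 0`: the product `x(1 - x)` is smallest when `t` or `r` is `1`.
  have htr : (t : ℝ) + r - 1 ≤ t * r := by
    have h1 : (1 : ℝ) ≤ t := by exact_mod_cast ht
    have h2 : (1 : ℝ) ≤ r := by exact_mod_cast hr
    nlinarith
  have hxx : x * (1 - x) = t * r / (t + r : ℕ) ^ 2 := by
    rw [hx]
    field_simp
    push_cast
    ring
  have hn2 : (2 : ℝ) ≤ (t + r : ℕ) := by exact_mod_cast (by omega : 2 ≤ t + r)
  set n : ℝ := ((t + r : ℕ) : ℝ) with hn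
  have hxn : (n - 1) / n ^ 2 ≤ x * (1 - x) := by
    rw [hxx]
    gcongr
    rw [hn]
    push_cast
    exact htr
  -- Here `cos 2θ ≥ 0`, so `q = M` is allowed and `M² ≥ n + 1` suffices.
  by_cases hhalf : (1 : ℝ) / 2 ≤ x
  · refine hkey3 ((n - 1) / n ^ 2) M (div_nonneg (by linarith) (by positivity)) hxn hMr
      (by linarith) ?_
    have : 4 * ((n - 1) / n ^ 2) * (M : ℝ) ^ 2 = 4 * (n - 1) * (M : ℝ) ^ 2 / n ^ 2 := by ring
    rw [this, le_div_iff₀ (by positivity)]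
    have : (n - 1) * (n + 1) ≤ (n - 1) * (M : ℝ) ^ 2 :=
      mul_le_mul_of_nonneg_left hMsq (by linarith)
    nlinarith
  push Not at hhalf
  have hx1 : 1 / n ≤ x := by
    rw [hx]
    gcongr
    exact_mod_cast hr
  have hx0 : 0 < x := by positivity
  have hrt : r < t := by
    rw [hx, div_lt_div_iff₀ (by positivity) two_pos] at hhalf
    have : r * 2 < 1 * (t + r) := by rw [hn] at hhalf; exact_mod_cast hhalf
    omega
  -- Now `cos 2θ` may be close to `-1`, which leaves only `q = M - 2`; this is enough from `M = 5`
  -- on. For `M = 2, 3, 4` integrality leaves few values of `x`.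
  by_cases hM5 : 5 ≤ M
  · have hM5' : (5 : ℝ) ≤ M := by exact_mod_cast hM5
    refine hkey3 ((n - 1) / n ^ 2) (M - 2) (div_nonneg (by linarith) (by positivity)) hxn
      (by linarith) (by linarith) ?_
    rw [show 4 * ((n - 1) / n ^ 2) * ((M : ℝ) - 2) ^ 2 =
      (4 * (n - 1) * ((M : ℝ) - 2) ^ 2) / n ^ 2 by ring, le_div_iff₀ (by positivity), one_mul]
    by_cases hn5 : n ≤ 5
    · have h9 : (9 : ℝ) ≤ ((M : ℝ) - 2) ^ 2 := by nlinarith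
      have h10 : (n - 1) * 9 ≤ (n - 1) * ((M : ℝ) - 2) ^ 2 :=
        mul_le_mul_of_nonneg_left h9 (by linarith)
      nlinarith
    · push Not at hn5
      have h9 : n ≤ 16 / 5 * ((M : ℝ) - 2) ^ 2 := by nlinarith
      have h10 : (n - 1) * n ≤ (n - 1) * (16 / 5 * ((M : ℝ) - 2) ^ 2) :=
        mul_le_mul_of_nonneg_left h9 (by linarith)
      nlinarith
  have hM2 : 2 ≤ M := by
    by_contra h
    have : M = 1 := by omega
    subst this
    omega
  interval_cases M
  · have ht2 : t = 2 := by omega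
    have hr1 : r = 1 := by omega
    subst ht2 hr1
    have hx3 : x = 1 / 3 := by rw [hx, hn]; norm_num
    obtain ⟨h3, h5, -⟩ := cos_odd_sq_eq θ
    rw [← hxdef, hx3] at h3 h5
    rw [failMean, mean, Finset.sum_Icc_succ_top (by norm_num), Finset.Icc_self,
      Finset.sum_singleton]
    norm_num
    rw [h3, h5]
    norm_num
  -- The general criterion works down to `x = 1/7`; the only smaller value with `n ≤ 8` is `1/8`,
  -- computed directly.
  · by_cases hx7 : 1 / 7 ≤ x
    · have h6 := mul_one_sub_le_mul_one_sub hx7 (by linarith)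
      refine hkey3 _ (11 / 7) (by norm_num) h6 (by norm_num) ?_ (by norm_num)
      norm_num
      linarith
    · push Not at hx7
      have h8 : (t + r) = 8 := by
        have h : 1 / n < 1 / 7 := hx1.trans_lt hx7
        rw [div_lt_div_iff₀ (by positivity) (by norm_num), hn] at h
        have : 1 * 7 < 1 * (t + r) := by exact_mod_cast h
        omega
      have hn8 : n = 8 := by rw [hn, h8]; norm_num
      have hr1 : r = 1 := by
        rw [hx, hn8, div_lt_div_iff₀ (by norm_num) (by norm_num)] at hx7
        have : r * 7 < 1 * 8 := by exact_mod_cast hx7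
        omega
      have hx8 : x = 1 / 8 := by rw [hx, hn8, hr1]; norm_num
      obtain ⟨h3, h5, h7⟩ := cos_odd_sq_eq θ
      rw [← hxdef, hx8] at h3 h5 h7
      rw [failMean, mean, Finset.sum_Icc_succ_top (by norm_num),
        Finset.sum_Icc_succ_top (by norm_num), Finset.Icc_self, Finset.sum_singleton]
      norm_num
      rw [h3, h5, h7]
      norm_num
  · have hx15 : 1 / 15 ≤ x := by
      refine le_trans ?_ hx1
      gcongr
      have : t + r ≤ 15 := by omega
      rw [hn]
      exact_mod_cast this
    have h14 := mul_one_sub_le_mul_one_sub hx15 (by linarith)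
    refine hkey3 _ (34 / 15) (by norm_num) h14 (by norm_num) ?_ (by norm_num)
    norm_num
    linarith

end Means

/-! ## Solutions of the recursive inequalities for the potentials -/

section Recursions

/-- The expected cost still to come, when an iteration costs at most `12 c ^ l` and its failure
probability `q` is eventually less than `1 / c`. -/
theorem exists_cost_bound {c : ℝ} (hc : 1 < c) (hc2 : c < 2) :
    ∃ β D : ℝ, 0 < β ∧ 0 < D ∧ ∀ (q : ℕ → ℝ) (y : ℝ), 0 ≤ y → (∀ l, 0 ≤ q l) →
      (∀ l, q l ≤ 1) → (∀ l, y ≤ c ^ l → q l ≤ 1 / 4 + 1 / (2 * c)) →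
      ∃ C : ℕ → ℝ, (∀ l, 0 ≤ C l) ∧ (∀ l, 12 * c ^ l + q (l + 1) * C (l + 1) ≤ C l) ∧
        C 0 ≤ β + D * y := by
  have hc0 : 0 < c := by linarith
  -- `β` solves the recursion for `C l = β c ^ l` at failure probability `1/4 + 1/(2c)`, the
  -- midpoint of `1/2` and `1/c`. `γ` makes the costs `12 c ^ l` telescope as differences of `γ c ^
  -- l`.
  obtain ⟨β, hβ⟩ : ∃ β : ℝ, β = 48 / (2 - c) := ⟨_, rfl⟩
  obtain ⟨γ, hγ⟩ : ∃ γ : ℝ, γ = 12 / (c - 1) := ⟨_, rfl⟩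
  have hβ0 : 0 < β := hβ ▸ div_pos (by norm_num) (by linarith)
  have hγ0 : 0 < γ := hγ ▸ div_pos (by norm_num) (by linarith)
  have hβ' : 12 + (c / 4 + 1 / 2) * β = β := by
    have : 2 - c ≠ 0 := by linarith
    rw [hβ]
    field_simp
    ring
  have hγ' : γ * (c - 1) = 12 := by
    rw [hγ]
    exact div_mul_cancel₀ _ (by linarith)
  refine ⟨β, γ + 12 + 2 * β, hβ0, by positivity, fun q y hy hq0 hq1 hq => ?_⟩
  have hpow : ∀ l, 0 < c ^ l := fun l => by positivity
  -- Before the threshold `y` only `q ≤ 1` is used and the budget falls by exactly the cost. The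
  -- multiple of `y` covers the step across the threshold, where `c ^ (l + 1) ≤ 2 y`.
  refine ⟨fun l => if y ≤ c ^ l then β * c ^ l else (γ + 12 + 2 * β) * y - γ * c ^ l,
    fun l => ?_, fun l => ?_, ?_⟩
  · simp only []
    split_ifs with h
    · have := hpow l
      positivity
    · have h1 : γ * c ^ l ≤ γ * y := by gcongr; linarith
      have h2 : 0 ≤ (12 + 2 * β) * y := by positivity
      linarith
  · have hstep : c ^ l ≤ c ^ (l + 1) := pow_le_pow_right₀ hc.le (Nat.le_succ l)
    have hsucc : c ^ (l + 1) = c * c ^ l := pow_succ' c l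
    simp only []
    by_cases h : y ≤ c ^ l
    · rw [if_pos h, if_pos (h.trans hstep)]
      have h1 := hq (l + 1) (h.trans hstep)
      have h2 : q (l + 1) * (β * c ^ (l + 1)) ≤ (1 / 4 + 1 / (2 * c)) * (β * c ^ (l + 1)) := by
        gcongr
      have h3 : (1 / 4 + 1 / (2 * c)) * (β * c ^ (l + 1)) = (c / 4 + 1 / 2) * β * c ^ l := by
        rw [hsucc]
        field_simp
      have h4 : (12 + (c / 4 + 1 / 2) * β) * c ^ l = β * c ^ l := by rw [hβ']
      linarith
    · push Not at h
      rw [if_neg (not_le.2 h)]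
      by_cases h' : y ≤ c ^ (l + 1)
      · rw [if_pos h']
        have h1 : q (l + 1) * (β * c ^ (l + 1)) ≤ 1 * (β * c ^ (l + 1)) := by
          gcongr
          exact hq1 _
        have h2 : β * c ^ (l + 1) ≤ β * (2 * y) := by
          rw [hsucc]
          gcongr
        have h3 : γ * c ^ l ≤ γ * y := by gcongr
        linarith
      · push Not at h'
        rw [if_neg (not_le.2 h')]
        have h1 : 0 ≤ (γ + 12 + 2 * β) * y - γ * c ^ (l + 1) := by
          have h1 : γ * c ^ (l + 1) ≤ γ * y := by gcongr
          have h2 : 0 ≤ (12 + 2 * β) * y := by positivity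
          linarith
        have h2 : q (l + 1) * ((γ + 12 + 2 * β) * y - γ * c ^ (l + 1)) ≤
            1 * ((γ + 12 + 2 * β) * y - γ * c ^ (l + 1)) := by
          gcongr
          exact hq1 _
        have h3 : γ * c ^ (l + 1) - γ * c ^ l = 12 * c ^ l := by
          rw [hsucc, ← hγ']
          ring
        linarith
  · simp only [pow_zero, mul_one]
    split_ifs with h
    · have : 0 ≤ (γ + 12 + 2 * β) * y := by positivity
      linarith
    · linarith

/-- The sum over `l` of the smaller of `36 c ^ (2 l)` and `B ^ 3 / c ^ l` is `O(B ^ 2)`. -/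
theorem exists_early_bound {c : ℝ} (hc : 1 < c) :
    ∃ E : ℝ, 0 < E ∧ ∀ B : ℝ, 0 < B → ∃ e : ℕ → ℝ, (∀ l, 0 ≤ e l) ∧
      (∀ (l : ℕ) (ε : ℝ), ε ≤ 36 * (c ^ (l + 1)) ^ 2 → ε ≤ B ^ 3 / c ^ (l + 1) →
        ε + e (l + 1) ≤ e l) ∧ e 0 ≤ E * B ^ 2 := by
  have hc0 : 0 < c := by linarith
  obtain ⟨δ, hδ⟩ : ∃ δ : ℝ, δ = 1 / (c - 1) := ⟨_, rfl⟩
  obtain ⟨η, hη⟩ : ∃ η : ℝ, η = 36 * c ^ 2 / (c ^ 2 - 1) := ⟨_, rfl⟩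
  have hcsq : 0 < c ^ 2 - 1 := by nlinarith
  have hδ0 : 0 < δ := hδ ▸ div_pos (by norm_num) (by linarith)
  have hη0 : 0 < η := hη ▸ div_pos (by positivity) hcsq
  have hδ' : δ * (c - 1) = 1 := by
    rw [hδ]
    exact div_mul_cancel₀ _ (by linarith)
  have hη' : η * (c ^ 2 - 1) = 36 * c ^ 2 := by
    rw [hη]
    exact div_mul_cancel₀ _ hcsq.ne'
  refine ⟨η + 36 * c ^ 2 + δ, by positivity, fun B hB => ?_⟩
  -- Above `B` this dominates the tail of a decreasing geometric series; below `B` it is a budget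
  -- from which the terms `36 c ^ (2l)` are subtracted. The term `36 c ^ 2` in the constant is slack
  -- for the crossing step.
  refine ⟨fun l => if B ≤ c ^ l then δ * (B ^ 3 / c ^ l) else
    (η + 36 * c ^ 2 + δ) * B ^ 2 - η * (c ^ l) ^ 2, fun l => ?_, fun l ε h1 h2 => ?_, ?_⟩
  · simp only []
    split_ifs with h
    · positivity
    · push Not at h
      have h1 : η * (c ^ l) ^ 2 ≤ η * B ^ 2 := by gcongr
      have h2 : 0 ≤ (36 * c ^ 2 + δ) * B ^ 2 := by positivity
      linarith
  · have hstep : c ^ l ≤ c ^ (l + 1) := pow_le_pow_right₀ hc.le (Nat.le_succ l)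
    have hsucc : c ^ (l + 1) = c * c ^ l := pow_succ' c l
    have hpl : 0 < c ^ l := by positivity
    simp only []
    by_cases h : B ≤ c ^ l
    · rw [if_pos h, if_pos (h.trans hstep)]
      have h3 : B ^ 3 / c ^ l = c * (B ^ 3 / c ^ (l + 1)) := by
        rw [hsucc]
        field_simp
      rw [h3]
      have h4 : δ * (c * (B ^ 3 / c ^ (l + 1))) - δ * (B ^ 3 / c ^ (l + 1)) =
          B ^ 3 / c ^ (l + 1) := by
        linear_combination (B ^ 3 / c ^ (l + 1)) * hδ'
      linarith
    · push Not at h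
      rw [if_neg (not_le.2 h)]
      by_cases h' : B ≤ c ^ (l + 1)
      · rw [if_pos h']
        have h3 : B ^ 3 / c ^ (l + 1) ≤ B ^ 2 := by
          rw [div_le_iff₀ (by positivity)]
          calc B ^ 3 = B ^ 2 * B := by ring
            _ ≤ _ := by gcongr
        have h4 : δ * (B ^ 3 / c ^ (l + 1)) ≤ δ * B ^ 2 := by gcongr
        have h5 : η * (c ^ l) ^ 2 ≤ η * B ^ 2 := by gcongr
        have h6 : 36 * (c ^ (l + 1)) ^ 2 ≤ 36 * c ^ 2 * B ^ 2 := by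
          rw [hsucc, mul_pow, ← mul_assoc]
          gcongr
        linarith
      · push Not at h'
        rw [if_neg (not_le.2 h')]
        have h3 : η * (c ^ (l + 1)) ^ 2 - η * (c ^ l) ^ 2 = 36 * (c ^ (l + 1)) ^ 2 := by
          rw [hsucc]
          linear_combination (c ^ l) ^ 2 * hη'
        linarith
  · simp only [pow_zero, div_one, one_pow, mul_one]
    have hBB : 0 ≤ (η + 36 * c ^ 2) * B ^ 2 := by positivity
    split_ifs with h
    · have : δ * B ^ 3 ≤ δ * B ^ 2 := by
        gcongr ?_ * ?_
        exact pow_le_pow_of_le_one hB.le h (by norm_num)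
      linarith
    · linarith

theorem ceil_pow_le {c : ℝ} (hc : 1 < c) (l : ℕ) : (⌈c ^ l⌉₊ : ℝ) ≤ 2 * c ^ l := by
  have h1 : (⌈c ^ l⌉₊ : ℝ) < c ^ l + 1 := Nat.ceil_lt_add_one (by positivity)
  have h2 : 1 ≤ c ^ l := one_le_pow₀ hc.le
  linarith

theorem ceil_pow_pos {c : ℝ} (hc : 1 < c) (l : ℕ) : 0 < ⌈c ^ l⌉₊ := Nat.ceil_pos.2 (by positivity)

/-- The mean over `j = 1, …, M` of the squares of those numbers `2 j + 1` that are below `B`. -/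
theorem mean_odd_sq_le {M : ℕ} (hM : 0 < M) {B : ℝ} (hB : 0 < B) :
    mean M (fun j => if (2 * j + 1 : ℝ) < B then (2 * j + 1 : ℝ) ^ 2 else 0) ≤ 9 * M ^ 2 ∧
    mean M (fun j => if (2 * j + 1 : ℝ) < B then (2 * j + 1 : ℝ) ^ 2 else 0) ≤ B ^ 3 / M := by
  have hMr : (0 : ℝ) < M := by exact_mod_cast hM
  constructor
  · rw [← mean_const hM (9 * (M : ℝ) ^ 2)]
    refine mean_le_mean fun j h1 h2 => ?_
    have h3 : (1 : ℝ) ≤ j := by exact_mod_cast h1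
    have h4 : (j : ℝ) ≤ M := by exact_mod_cast h2
    split_ifs
    · nlinarith
    · positivity
  · refine div_le_div_of_nonneg_right ?_ hMr.le
    rw [← Finset.sum_filter]
    calc ∑ j ∈ (Finset.Icc 1 M).filter (fun j : ℕ => (2 * j + 1 : ℝ) < B), (2 * j + 1 : ℝ) ^ 2
        ≤ ∑ j ∈ (Finset.Icc 1 M).filter (fun j : ℕ => (2 * j + 1 : ℝ) < B), B ^ 2 := by
          refine Finset.sum_le_sum fun j hj => ?_
          have := (Finset.mem_filter.1 hj).2
          gcongr
      _ ≤ ∑ j ∈ Finset.Icc 1 ⌊B⌋₊, B ^ 2 := by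
          refine Finset.sum_le_sum_of_subset_of_nonneg (fun j hj => ?_) fun _ _ _ => by positivity
          obtain ⟨h1, h2⟩ := Finset.mem_filter.1 hj
          refine Finset.mem_Icc.2 ⟨(Finset.mem_Icc.1 h1).1, Nat.le_floor ?_⟩
          have : (0 : ℝ) ≤ j := by positivity
          linarith
      _ = ⌊B⌋₊ * B ^ 2 := by simp
      _ ≤ B * B ^ 2 := by
          gcongr
          exact Nat.floor_le hB.le
      _ = B ^ 3 := by ring

end Recursions

/-! ## Bounds for modified QSearch -/

theorem expectedCalls_eq_expect {ι : Type} (ρ : PMF (SearchState ι)) :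
    expectedCalls ρ = expect ρ fun σ => (σ.calls : ℝ≥0∞) := rfl

section Bounds

variable {ι : Type} [Fintype ι] [DecidableEq ι] (O : Matrix.unitaryGroup ι ℂ)
    (A : Circuit ι) (zero : ι) (good : ι → Prop) [DecidablePred good] (N : ℕ) (τ c : ℝ)
    (hc : 1 < c) (θ : ℝ)

theorem three_quarters_pow_ceil_le {τ : ℝ} (hτ : 0 < τ) :
    (3 / 4 : ℝ) ^ ⌈Real.log τ / Real.log (3 / 4)⌉₊ ≤ τ := by
  have hlog : Real.log (3 / 4) < 0 := Real.log_neg (by norm_num) (by norm_num)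
  rw [← Real.log_le_log_iff (by positivity) hτ, Real.log_pow]
  exact (div_le_iff_of_neg hlog).1 (Nat.le_ceil _)

/-- The potential is `(3/4)` to the number of counted iterations still due: a counted iteration pays
its factor `3/4`, an uncounted one does no harm. Truncated subtraction gives the value `1` at the
exit. -/
theorem prob_isFailed_le (hA : Circuit.calls A = 1)
    (hθ : weight (Circuit.eval O A) zero good = Real.sin θ ^ 2)
    (hq : ∀ M : ℕ, Real.sqrt N < M → failMean θ M ≤ 3 / 4) (k : ℕ) :
    prob (modifiedQSearch O A zero good N τ c hc k) SearchState.IsFailed ≤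
      ENNReal.ofReal (Real.cos θ ^ 2 * (3 / 4) ^ ⌈Real.log τ / Real.log (3 / 4)⌉₊) := by
  classical
  set n := ⌈Real.log τ / Real.log (3 / 4)⌉₊ with hn
  refine le_trans ?_ (expect_potential_le O A zero good N τ c hc θ hA hθ
    (Real.cos θ ^ 2 * (3 / 4) ^ n) (fun _ u _ => (3 / 4) ^ (n - u)) (fun _ => 0) (fun _ => 1)
    (fun _ _ _ => by positivity) (fun _ => le_rfl) (by simp) ?_ ?_ k)
  · rw [prob_eq_expect]
    refine expect_mono _ fun σ _ => ?_
    cases σ <;> simp [SearchState.IsFailed, potential]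
  · intro l u m hu
    have hun : u < n := Nat.lt_ceil.2 hu
    have h : loopMean θ N c (fun _ u _ => (3 / 4) ^ (n - u)) (fun _ => 0) l u m =
        failMean θ ⌈c ^ (l + 1)⌉₊ * (3 / 4) ^ (n - nextCount N c (l + 1) u) := by
      rw [loopMean, failMean, ← mean_mul_const]
      simp
    rw [h, nextCount]
    split_ifs with h1
    · have h2 : (3 / 4 : ℝ) ^ (n - u) = 3 / 4 * (3 / 4) ^ (n - (u + 1)) := by
        rw [← pow_succ']
        congr 1
        omega
      rw [h2]
      gcongr
      exact hq _ h1
    · exact mul_le_of_le_one_left (by positivity) (failMean_le_one θ (ceil_pow_pos hc _))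
  · intro l u m hu
    have hun : n ≤ u := Nat.ceil_le.2 hu
    simp [Nat.sub_eq_zero_of_le hun]

/-- The potential is the calls already made plus the budget `C l`. An iteration costs `2j + 1 ≤ 3M ≤
12 c ^ l`, since `M ≤ 2 c ^ (l + 1)` and `c < 2`. -/
theorem expectedCalls_le (hA : Circuit.calls A = 1)
    (hθ : weight (Circuit.eval O A) zero good = Real.sin θ ^ 2) (C : ℕ → ℝ)
    (hC0 : ∀ l, 0 ≤ C l)
    (hC : ∀ l, 12 * c ^ l + failMean θ ⌈c ^ (l + 1)⌉₊ * C (l + 1) ≤ C l) (hc2 : c < 2) (k : ℕ) :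
    expectedCalls (modifiedQSearch O A zero good N τ c hc k) ≤
      ENNReal.ofReal (1 + Real.cos θ ^ 2 * C 0) := by
  refine le_trans ?_ (expect_potential_le O A zero good N τ c hc θ hA hθ
    (1 + Real.cos θ ^ 2 * C 0) (fun l _ m => m + C l) (fun m => m) (fun m => m)
    (fun l _ m => add_nonneg (Nat.cast_nonneg m) (hC0 l)) (fun m => Nat.cast_nonneg m) ?_ ?_ ?_ k)
  · rw [expectedCalls_eq_expect]
    refine expect_mono _ fun σ _ => ?_
    cases σ with
    | start => simp [SearchState.calls]
    | loop l u m =>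
      rw [SearchState.calls, potential, ← ENNReal.ofReal_natCast]
      exact ENNReal.ofReal_le_ofReal (by linarith [hC0 l])
    | found b m => simp [SearchState.calls, potential]
    | failed m => simp [SearchState.calls, potential]
  · have := Real.sin_sq_add_cos_sq θ
    push_cast
    linarith
  · intro l u m _
    set M := ⌈c ^ (l + 1)⌉₊ with hM
    have hMpos : 0 < M := ceil_pow_pos hc _
    have h1 : (1 : ℝ) ≤ M := by exact_mod_cast hMpos
    have h2 : (M : ℝ) ≤ 2 * c ^ (l + 1) := ceil_pow_le hc _
    have h3 : (M : ℝ) ≤ 4 * c ^ l := by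
      have : c ^ (l + 1) ≤ 2 * c ^ l := by
        rw [pow_succ']
        gcongr
      linarith
    have h4 : loopMean θ N c (fun l _ m => m + C l) (fun m => m) l u m ≤
        mean M (fun j => (m + 3 * M) + Real.cos ((2 * j + 1) * θ) ^ 2 * C (l + 1)) := by
      refine mean_le_mean fun j hj1 hj2 => ?_
      have hj : (j : ℝ) ≤ M := by exact_mod_cast hj2
      have := Real.sin_sq_add_cos_sq ((2 * j + 1) * θ)
      push_cast
      nlinarith
    refine h4.trans ?_
    rw [mean_add, mean_mul_const, mean_const hMpos]
    have h5 := hC l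
    change (m : ℝ) + 3 * M + failMean θ M * C (l + 1) ≤ m + C l
    linarith
  · intro l _ m _
    linarith [hC0 l]

theorem prob_found_early_le (hA : Circuit.calls A = 1)
    (hθ : weight (Circuit.eval O A) zero good = Real.sin θ ^ 2) {B E : ℝ} (hB : 0 < B)
    (e : ℕ → ℝ) (he0 : ∀ l, 0 ≤ e l)
    (he : ∀ (l : ℕ) (ε : ℝ), ε ≤ 36 * (c ^ (l + 1)) ^ 2 → ε ≤ B ^ 3 / c ^ (l + 1) →
        ε + e (l + 1) ≤ e l) (heE : e 0 ≤ E * B ^ 2) (k : ℕ) :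
    prob (modifiedQSearch O A zero good N τ c hc k) (fun σ => σ.IsFound ∧ (σ.calls : ℝ) < B) ≤
      ENNReal.ofReal (Real.sin θ ^ 2 * ((1 + E) * B ^ 2)) := by
  classical
  refine le_trans ?_ (expect_potential_le O A zero good N τ c hc θ hA hθ
    (Real.sin θ ^ 2 * ((1 + E) * B ^ 2)) (fun l _ _ => Real.sin θ ^ 2 * e l)
    (fun m => if (m : ℝ) < B then 1 else 0) (fun _ => 0)
    (fun l _ _ => mul_nonneg (sq_nonneg _) (he0 l)) (fun m => by split_ifs <;> norm_num)
    ?_ ?_ ?_ k)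
  · rw [prob_eq_expect]
    refine expect_mono _ fun σ _ => ?_
    cases σ with
    | found b m =>
      by_cases h : (m : ℝ) < B <;> simp [SearchState.IsFound, SearchState.calls, potential, h]
    | _ => simp [SearchState.IsFound]
  · have h1 : (if ((1 : ℕ) : ℝ) < B then (1 : ℝ) else 0) ≤ B ^ 2 := by
      split_ifs with h
      · push_cast at h
        nlinarith
      · positivity
    have h2 : Real.cos θ ^ 2 * (Real.sin θ ^ 2 * e 0) ≤ 1 * (Real.sin θ ^ 2 * e 0) := by
      have := he0 0
      gcongr
      exact Real.cos_sq_le_one θ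
    have h3 : Real.sin θ ^ 2 * (if ((1 : ℕ) : ℝ) < B then (1 : ℝ) else 0) ≤
        Real.sin θ ^ 2 * B ^ 2 := by gcongr
    have h4 : Real.sin θ ^ 2 * e 0 ≤ Real.sin θ ^ 2 * (E * B ^ 2) := by gcongr
    linarith
  · intro l u m _
    set M := ⌈c ^ (l + 1)⌉₊ with hM
    have hMpos : 0 < M := ceil_pow_pos hc _
    have hMr : (0 : ℝ) < M := by exact_mod_cast hMpos
    obtain ⟨h1, h2⟩ := mean_odd_sq_le hMpos hB
    set ε := mean M (fun j => if (2 * j + 1 : ℝ) < B then (2 * j + 1 : ℝ) ^ 2 else 0) with hε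
    -- Calls made earlier can only help: a total below `B` forces `2j + 1 < B` in this iteration
    -- alone.
    have h3 : loopMean θ N c (fun l _ _ => Real.sin θ ^ 2 * e l)
        (fun m => if (m : ℝ) < B then 1 else 0) l u m ≤
        mean M (fun j => (if (2 * j + 1 : ℝ) < B then (2 * j + 1 : ℝ) ^ 2 else 0) *
          Real.sin θ ^ 2 + Real.sin θ ^ 2 * e (l + 1)) := by
      refine mean_le_mean fun j _ _ => add_le_add ?_ ?_
      · by_cases h : ((m + (2 * j + 1) : ℕ) : ℝ) < B
        · have h' : (2 * j + 1 : ℝ) < B := by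
            push_cast at h
            have : (0 : ℝ) ≤ m := Nat.cast_nonneg m
            linarith
          simp only [if_pos h, if_pos h', mul_one, ← mul_pow]
          refine sq_le_sq.2 ((abs_sin_odd_mul_le θ j).trans_eq ?_)
          rw [abs_mul, abs_of_nonneg (by positivity : (0 : ℝ) ≤ 2 * j + 1)]
        · simp only [if_neg h, mul_zero]
          split_ifs <;> positivity
      · have := he0 (l + 1)
        exact mul_le_of_le_one_left (by positivity) (Real.cos_sq_le_one _)
    refine h3.trans ?_
    rw [mean_add, mean_mul_const, mean_const hMpos, ← hε]
    have h4 : ε + e (l + 1) ≤ e l := by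
      refine he l ε (h1.trans ?_) (h2.trans ?_)
      · have := ceil_pow_le hc (l + 1)
        calc 9 * (M : ℝ) ^ 2 ≤ 9 * (2 * c ^ (l + 1)) ^ 2 := by gcongr
          _ = _ := by ring
      · gcongr
        exact Nat.le_ceil _
    calc ε * Real.sin θ ^ 2 + Real.sin θ ^ 2 * e (l + 1) = Real.sin θ ^ 2 * (ε + e (l + 1)) := by
          ring
      _ ≤ _ := by gcongr
  · intro l _ _ _
    exact mul_nonneg (sq_nonneg _) (he0 l)

end Bounds

/-! ### Combining the potentials into the failure and cost bounds. -/

section Main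

open Classical in
theorem expectedCallsIfFound_eq {ι : Type} (ρ : PMF (SearchState ι)) :
    expectedCallsIfFound ρ = (expect ρ fun σ => if σ.IsFound then (σ.calls : ℝ≥0∞) else 0) /
      prob ρ SearchState.IsFound := by
  rw [expectedCallsIfFound, expect]
  congr 1
  refine tsum_congr fun σ => ?_
  split_ifs <;> simp

theorem one_le_prob_isFound_add_prob_isFailed {ι : Type} {ρ : PMF (SearchState ι)}
    (h : ∀ σ ∈ ρ.support, σ.IsFound ∨ σ.IsFailed) :
    1 ≤ prob ρ SearchState.IsFound + prob ρ SearchState.IsFailed := by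
  classical
  rw [prob_eq_expect, prob_eq_expect, ← expect_add]
  refine (expect_const ρ 1).symm.trans_le (expect_mono ρ fun σ hσ => ?_)
  rcases h σ hσ with h | h <;> simp [h]

open Classical in
/-- If the tolerance is at least `1`, a desired state is only found by the first measurement. -/
theorem expect_found_calls_le_prob {ι : Type} [Fintype ι] [DecidableEq ι]
    (O : Matrix.unitaryGroup ι ℂ) (A : Circuit ι) (zero : ι) (good : ι → Prop)
    [DecidablePred good] (N : ℕ) (τ c : ℝ) (hc : 1 < c) (θ : ℝ) (hA : Circuit.calls A = 1)
    (hθ : weight (Circuit.eval O A) zero good = Real.sin θ ^ 2) (hτ : 1 ≤ τ) (k : ℕ) :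
    (expect (modifiedQSearch O A zero good N τ c hc k)
      fun σ => if σ.IsFound then (σ.calls : ℝ≥0∞) else 0) ≤
      prob (modifiedQSearch O A zero good N τ c hc k) SearchState.IsFound := by
  have hR : Real.log τ / Real.log (3 / 4) ≤ 0 :=
    div_nonpos_of_nonneg_of_nonpos (Real.log_nonneg hτ)
      (Real.log_nonpos (by norm_num) (by norm_num))
  -- The potential charges only finds that did not take exactly one call. The loop is never
  -- executed, so its expectation stays `0`.
  have h := expect_potential_le O A zero good N τ c hc θ hA hθ 0 (fun _ _ _ => 0)
    (fun m => if m = 1 then 0 else m) (fun _ => 0) (fun _ _ _ => le_rfl)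
    (fun m => by split_ifs <;> positivity) (by simp) (fun l u m hu => by
      have : (0 : ℝ) ≤ u := Nat.cast_nonneg u
      linarith) (fun _ _ _ _ => le_rfl) k
  rw [ENNReal.ofReal_zero, nonpos_iff_eq_zero] at h
  rw [prob_eq_expect]
  refine le_of_le_of_eq ?_ ((congrArg (_ + ·) h).trans (add_zero _))
  rw [← expect_add]
  refine expect_mono _ fun σ _ => ?_
  cases σ with
  | found b m =>
    by_cases hm : m = 1 <;> simp [SearchState.IsFound, SearchState.calls, potential, hm]
  | _ => simp [SearchState.IsFound]

/-- Failure probability and expected number of oracle calls of modified QSearch, for an algorithm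
`A` that makes one oracle call and has success probability `t / N`. -/
theorem modifiedQSearch_bounds {c : ℝ} (hc : 1 < c) (hc2 : c < 2) :
    ∃ κ₁ κ₂ : ℝ, 0 < κ₁ ∧ 0 < κ₂ ∧ ∀ {ι : Type} [Fintype ι] [DecidableEq ι]
      (O : Matrix.unitaryGroup ι ℂ) (A : Circuit ι) (zero : ι) (good : ι → Prop)
      [DecidablePred good] (N t : ℕ) (τ : ℝ) (k : ℕ), Circuit.calls A = 1 → 0 < t → t ≤ N →
      weight (Circuit.eval O A) zero good = t / N → 0 < τ →
      (∀ σ ∈ (modifiedQSearch O A zero good N τ c hc k).support, σ.IsFound ∨ σ.IsFailed) →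
      prob (modifiedQSearch O A zero good N τ c hc k) SearchState.IsFailed < ENNReal.ofReal τ ∧
      expectedCalls (modifiedQSearch O A zero good N τ c hc k) ≤
        ENNReal.ofReal (κ₂ * Real.sqrt (N / t)) ∧
      expectedCallsIfFound (modifiedQSearch O A zero good N τ c hc k) ≤
        ENNReal.ofReal (κ₂ * Real.sqrt (N / t)) ∧
      (τ < 1 → ENNReal.ofReal (κ₁ * Real.sqrt (N / t)) ≤
          expectedCalls (modifiedQSearch O A zero good N τ c hc k) ∧
        ENNReal.ofReal (κ₁ * Real.sqrt (N / t)) ≤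
          expectedCallsIfFound (modifiedQSearch O A zero good N τ c hc k)) := by
  classical
  obtain ⟨β, D, hβ, hD, hcost⟩ := exists_cost_bound hc hc2
  obtain ⟨E, hE, hearly⟩ := exists_early_bound hc
  -- `K` is the value of `M sin 2θ` at which `failMean_le_half_add` gives the failure probability
  -- required by `exists_cost_bound`.
  obtain ⟨K, hK⟩ : ∃ K : ℝ, K = 3 * c / (2 - c) := ⟨_, rfl⟩
  have hK0 : 0 < K := hK ▸ div_pos (by linarith) (by linarith)
  have hK' : 1 / 2 + 3 / (4 * K) = 1 / 4 + 1 / (2 * c) := by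
    have h1 : 2 - c ≠ 0 := by linarith
    have h2 : c ≠ 0 := by linarith
    rw [hK]
    field_simp
    ring
  obtain ⟨δ, hδ⟩ : ∃ δ : ℝ, δ = Real.sqrt (1 / (8 * (1 + E))) := ⟨_, rfl⟩
  have hδ0 : 0 < δ := hδ ▸ Real.sqrt_pos.2 (by positivity)
  have hδ2 : (1 + E) * δ ^ 2 = 1 / 8 := by
    rw [hδ, Real.sq_sqrt (by positivity)]
    field_simp
  -- The factor `4` pays for conditioning on an event of probability at least `1/4`; `δ / 8` is a
  -- cost `δ w` incurred with probability at least `1/8`.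
  refine ⟨δ / 8, 4 * (1 + β + D * K), by positivity, by positivity, ?_⟩
  intro ι _ _ O A zero good _ N t τ k hA ht htN hw hτ hhalt
  set ρ := modifiedQSearch O A zero good N τ c hc k with hρ
  set w := Real.sqrt (N / t) with hwdef
  have htr : (0 : ℝ) < t := by exact_mod_cast ht
  have hNr : (0 : ℝ) < N := by exact_mod_cast (ht.trans_le htN)
  have htNr : (t : ℝ) ≤ N := by exact_mod_cast htN
  have hw1 : 1 ≤ w := Real.one_le_sqrt.2 ((one_le_div htr).2 htNr)
  have hw2 : (t : ℝ) / N * w ^ 2 = 1 := by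
    rw [hwdef, Real.sq_sqrt (by positivity)]
    field_simp
  obtain ⟨θ, hθdef⟩ : ∃ θ : ℝ, θ = Real.arcsin (Real.sqrt (t / N)) := ⟨_, rfl⟩
  have ha1 : (t : ℝ) / N ≤ 1 := (div_le_one hNr).2 htNr
  have hsin : Real.sin θ = Real.sqrt (t / N) := by
    rw [hθdef, Real.sin_arcsin _ (Real.sqrt_le_one.2 ha1)]
    linarith [Real.sqrt_nonneg ((t : ℝ) / N)]
  have hsin2 : Real.sin θ ^ 2 = t / N := by rw [hsin, Real.sq_sqrt (by positivity)]
  have hθ0 : 0 ≤ θ := hθdef ▸ Real.arcsin_nonneg.2 (Real.sqrt_nonneg _)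
  have hθ1 : θ ≤ Real.pi / 2 := hθdef ▸ Real.arcsin_le_pi_div_two _
  have hs0 : 0 < Real.sin θ := hsin ▸ Real.sqrt_pos.2 (by positivity)
  have hc0 : 0 ≤ Real.cos θ :=
    Real.cos_nonneg_of_neg_pi_div_two_le_of_le (by linarith [Real.pi_pos]) hθ1
  have hsw : Real.sin θ * w = 1 := by
    have : (Real.sin θ * w) ^ 2 = 1 := by rw [mul_pow, hsin2, hw2]
    exact (pow_eq_one_iff_of_nonneg (by positivity) two_ne_zero).1 this
  have hwθ : weight (Circuit.eval O A) zero good = Real.sin θ ^ 2 := hw.trans hsin2.symm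
  have hq : ∀ M : ℕ, Real.sqrt N < M → failMean θ M ≤ 3 / 4 := by
    intro M hM
    refine failMean_le_three_quarters ht htN ?_ hθ0 hθ1 hsin2
    have := (Real.sqrt_lt' (lt_of_le_of_lt (Real.sqrt_nonneg _) hM)).1 hM
    exact_mod_cast this
  have hfail := prob_isFailed_le O A zero good N τ c hc θ hA hwθ hq k
  rw [← hρ] at hfail
  have hpow := three_quarters_pow_ceil_le hτ
  have hcos_lt : Real.cos θ ^ 2 < 1 := by
    have := Real.sin_sq_add_cos_sq θ
    nlinarith
  set n := ⌈Real.log τ / Real.log (3 / 4)⌉₊ with hn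
  have hfoundfail := one_le_prob_isFound_add_prob_isFailed hhalt
  have hquarter : τ < 1 → ENNReal.ofReal (1 / 4) ≤ prob ρ SearchState.IsFound := by
    intro hτ1
    have hn1 : 1 ≤ n := Nat.one_le_iff_ne_zero.2 (Nat.ceil_pos.2 (div_pos_of_neg_of_neg
      (Real.log_neg hτ hτ1) (Real.log_neg (by norm_num) (by norm_num)))).ne'
    have h1 : prob ρ SearchState.IsFailed ≤ ENNReal.ofReal (3 / 4) := by
      refine hfail.trans (ENNReal.ofReal_le_ofReal ?_)
      have h2 : (3 / 4 : ℝ) ^ n ≤ (3 / 4) ^ 1 :=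
        pow_le_pow_of_le_one (by norm_num) (by norm_num) hn1
      have h3 : (0 : ℝ) < (3 / 4) ^ n := by positivity
      nlinarith
    have h2 : ENNReal.ofReal (1 / 4) + ENNReal.ofReal (3 / 4) ≤
        prob ρ SearchState.IsFound + ENNReal.ofReal (3 / 4) := by
      rw [← ENNReal.ofReal_add (by norm_num) (by norm_num)]
      norm_num
      refine hfoundfail.trans ?_
      gcongr
    exact (ENNReal.add_le_add_iff_right ENNReal.ofReal_ne_top).1 h2
  have hcalls : expectedCalls ρ ≤ ENNReal.ofReal ((1 + β + D * K) * w) := by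
    have hS0 : 0 ≤ Real.sin (2 * θ) := by
      rw [Real.sin_two_mul]
      positivity
    -- If every point is improved, `sin 2θ = 0` and the threshold is `0` by the convention for
    -- division; the failure probability is then `0` throughout.
    obtain ⟨C, hC0, hC, hCle⟩ := hcost (fun l => failMean θ ⌈c ^ l⌉₊) (K / Real.sin (2 * θ))
      (div_nonneg hK0.le hS0) (fun l => failMean_nonneg θ _)
      (fun l => failMean_le_one θ (ceil_pow_pos hc l)) (fun l hl => by
        rcases hS0.eq_or_lt with h | h
        · have hcos : Real.cos θ = 0 := by
            rw [Real.sin_two_mul] at h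
            rcases mul_eq_zero.1 h.symm with h | h
            · linarith
            · exact h
          rw [failMean_eq_zero hcos]
          have : 0 < c := by linarith
          positivity
        · rw [← hK']
          refine failMean_le_half_add (ceil_pow_pos hc l) hK0 ?_
          rw [div_le_iff₀ h] at hl
          refine hl.trans ?_
          gcongr
          exact Nat.le_ceil _)
    refine (expectedCalls_le O A zero good N τ c hc θ hA hwθ C hC0 hC hc2 k).trans
      (ENNReal.ofReal_le_ofReal ?_)
    -- Near `θ = π/2` the threshold `K / sin 2θ` far exceeds `w`; the small probability `cos² θ` of
    -- entering the loop compensates.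
    have hy : Real.cos θ ^ 2 * (K / Real.sin (2 * θ)) ≤ K * w := by
      rcases hc0.eq_or_lt with h | h
      · rw [← h]
        norm_num
        positivity
      · have hw' : w = 1 / Real.sin θ := by
          rw [eq_div_iff hs0.ne', mul_comm]
          exact hsw
        have h1 : Real.cos θ ^ 2 * (K / Real.sin (2 * θ)) = (Real.cos θ / 2) * (K * w) := by
          rw [hw', Real.sin_two_mul]
          field_simp
        rw [h1]
        refine mul_le_of_le_one_left (by positivity) ?_
        linarith [Real.cos_le_one θ]
    have h1 : Real.cos θ ^ 2 * C 0 ≤ Real.cos θ ^ 2 * (β + D * (K / Real.sin (2 * θ))) := by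
      gcongr
    have h2 : D * (Real.cos θ ^ 2 * (K / Real.sin (2 * θ))) ≤ D * (K * w) := by gcongr
    have h3 : Real.cos θ ^ 2 * β ≤ 1 * β := by gcongr
    have h4 : β * 1 ≤ β * w := by gcongr
    linarith
  have hle : (expect ρ fun σ => if σ.IsFound then (σ.calls : ℝ≥0∞) else 0) ≤ expectedCalls ρ := by
    rw [expectedCalls_eq_expect]
    refine expect_mono ρ fun σ _ => ?_
    split_ifs
    · exact le_rfl
    · exact zero_le
  have hκ : 0 < 1 + β + D * K := by positivity
  refine ⟨?_, hcalls.trans (ENNReal.ofReal_le_ofReal ?_), ?_, fun hτ1 => ?_⟩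
  · refine hfail.trans_lt ((ENNReal.ofReal_lt_ofReal_iff hτ).2 ?_)
    have h3 : (0 : ℝ) < (3 / 4) ^ n := by positivity
    nlinarith
  · gcongr
    linarith
  · rw [expectedCallsIfFound_eq]
    refine ENNReal.div_le_of_le_mul ?_
    by_cases hτ1 : τ < 1
    · refine (hle.trans hcalls).trans ?_
      have h1 : ENNReal.ofReal ((1 + β + D * K) * w) =
          ENNReal.ofReal (4 * (1 + β + D * K) * w) * ENNReal.ofReal (1 / 4) := by
        rw [← ENNReal.ofReal_mul (by positivity)]
        congr 1
        ring
      rw [h1]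
      gcongr
      exact hquarter hτ1
    · refine (expect_found_calls_le_prob O A zero good N τ c hc θ hA hwθ (not_lt.1 hτ1) k).trans ?_
      refine le_mul_of_one_le_left (zero_le) ?_
      rw [← ENNReal.ofReal_one]
      refine ENNReal.ofReal_le_ofReal ?_
      exact one_le_mul_of_one_le_of_one_le (by linarith [mul_pos hD hK0]) hw1
  · have hlow : ENNReal.ofReal (δ / 8 * w) ≤
        expect ρ fun σ => if σ.IsFound then (σ.calls : ℝ≥0∞) else 0 := by
      have hB : 0 < δ * w := by positivity
      obtain ⟨e, he0, he, heE⟩ := hearly (δ * w) hB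
      have h1 := prob_found_early_le O A zero good N τ c hc θ hA hwθ hB e he0 he heE k
      have h2 : Real.sin θ ^ 2 * ((1 + E) * (δ * w) ^ 2) = 1 / 8 := by
        rw [hsin2, mul_pow, ← hδ2]
        linear_combination (1 + E) * δ ^ 2 * hw2
      rw [h2, ← hρ] at h1
      -- A Markov-type inequality: every find either costs at least `δ w` or counts as early.
      have h3 : ENNReal.ofReal (δ * w) * prob ρ SearchState.IsFound ≤
          (expect ρ fun σ => if σ.IsFound then (σ.calls : ℝ≥0∞) else 0) +
            ENNReal.ofReal (δ * w) *
              prob ρ (fun σ => σ.IsFound ∧ (σ.calls : ℝ) < δ * w) := by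
        rw [prob_eq_expect, prob_eq_expect, ← expect_const_mul, ← expect_const_mul, ← expect_add]
        refine expect_mono ρ fun σ _ => ?_
        by_cases hf : σ.IsFound
        · by_cases hb : (σ.calls : ℝ) < δ * w
          · simp [hf, hb]
          · simp only [hf, hb, if_true, and_false, if_false, mul_one, mul_zero, add_zero]
            rw [← ENNReal.ofReal_natCast]
            exact ENNReal.ofReal_le_ofReal (not_lt.1 hb)
        · simp [hf]
      have h4 : ENNReal.ofReal (δ / 8 * w) + ENNReal.ofReal (δ / 8 * w) ≤
          (expect ρ fun σ => if σ.IsFound then (σ.calls : ℝ≥0∞) else 0) +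
            ENNReal.ofReal (δ / 8 * w) := by
        calc ENNReal.ofReal (δ / 8 * w) + ENNReal.ofReal (δ / 8 * w) =
            ENNReal.ofReal (δ * w) * ENNReal.ofReal (1 / 4) := by
              rw [← ENNReal.ofReal_add (by positivity) (by positivity),
                ← ENNReal.ofReal_mul (by positivity)]
              congr 1
              ring
          _ ≤ ENNReal.ofReal (δ * w) * prob ρ SearchState.IsFound := by
              gcongr
              exact hquarter hτ1
          _ ≤ _ := h3
          _ ≤ (expect ρ fun σ => if σ.IsFound then (σ.calls : ℝ≥0∞) else 0) +
              ENNReal.ofReal (δ * w) * ENNReal.ofReal (1 / 8) := by gcongr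
          _ = _ := by
              rw [← ENNReal.ofReal_mul (by positivity)]
              congr 2
              ring
      exact (ENNReal.add_le_add_iff_right ENNReal.ofReal_ne_top).1 h4
    refine ⟨hlow.trans hle, hlow.trans ?_⟩
    rw [expectedCallsIfFound_eq]
    calc _ = (expect ρ fun σ => if σ.IsFound then (σ.calls : ℝ≥0∞) else 0) / 1 := by
          rw [div_one]
      _ ≤ _ := ENNReal.div_le_div_left (prob_le_one _ _) _

end Main

/-! ## The state prepared by the search circuit -/

section SearchCircuit

/-- Two registers in the states `v` and `w`. -/
def tensor {α β : Type} (v : α → ℂ) (w : β → ℂ) : α × β → ℂ := fun b => v b.1 * w b.2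

theorem tensor_single {α β : Type} [DecidableEq α] [DecidableEq β] (a : α) (b : β) :
    tensor (Pi.single a 1) (Pi.single b 1) = Pi.single (a, b) (1 : ℂ) := by
  funext ⟨x, y⟩
  by_cases h1 : x = a <;> by_cases h2 : y = b <;> simp [tensor, h1, h2]

variable {α β : Type} [Fintype α] [DecidableEq α] [Fintype β] [DecidableEq β]

theorem onLeft_mulVec_tensor (U : Matrix.unitaryGroup α ℂ) (v : α → ℂ) (w : β → ℂ) :
    (onLeft (β := β) U).1.mulVec (tensor v w) = tensor (U.1.mulVec v) w := by
  funext ⟨x, y⟩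
  simp only [onLeft, tensor, Matrix.mulVec, dotProduct, Matrix.kroneckerMap_apply,
    Fintype.sum_prod_type, Matrix.one_apply, Finset.sum_mul]
  refine Finset.sum_congr rfl fun i _ => ?_
  rw [Finset.sum_eq_single y]
  · simp
    ring
  · intro z _ hz
    simp [hz.symm]
  · simp

theorem onRight_mulVec_tensor (U : Matrix.unitaryGroup β ℂ) (v : α → ℂ) (w : β → ℂ) :
    (onRight (α := α) U).1.mulVec (tensor v w) = tensor v (U.1.mulVec w) := by
  funext ⟨x, y⟩
  simp only [onRight, tensor, Matrix.mulVec, dotProduct, Matrix.kroneckerMap_apply,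
    Fintype.sum_prod_type, Matrix.one_apply, Finset.mul_sum]
  rw [Finset.sum_eq_single x]
  · refine Finset.sum_congr rfl fun i _ => ?_
    simp
    ring
  · intro z _ hz
    simp [hz.symm]
  · simp

theorem Circuit.eval_cons_mulVec {ι : Type} [Fintype ι] [DecidableEq ι]
    (O : Matrix.unitaryGroup ι ℂ) (g : Gate ι) (C : Circuit ι) (v : ι → ℂ) :
    (Circuit.eval O (g :: C)).1.mulVec v =
      (Circuit.eval O C).1.mulVec ((g.eval O).1.mulVec v) := by
  rw [Circuit.eval, Matrix.UnitaryGroup.mul_val, Matrix.mulVec_mulVec]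

theorem Circuit.eval_nil_mulVec {ι : Type} [Fintype ι] [DecidableEq ι]
    (O : Matrix.unitaryGroup ι ℂ) (v : ι → ℂ) :
    (Circuit.eval O []).1.mulVec v = v := by
  simp [Circuit.eval]

theorem xorGate_mulVec_zero {d : ℕ} (v : BitVec d) :
    (xorGate v).1.mulVec (Pi.single 0#d 1) = Pi.single v 1 := by
  funext i
  simp [xorGate, Pi.single_apply]

/-- In the Fourier basis a translation is multiplication by a character, so the controlled phases
perform the addition. Overflow of bit vectors is harmless because the phases have period `2 ^ d`. -/
theorem fourierPhase_add {d : ℕ} (a v w : BitVec d) :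
    fourierPhase v a * fourierPhase a w = fourierPhase a (w + v) := by
  rw [fourierPhase_eq_stdAddChar, fourierPhase_eq_stdAddChar, fourierPhase_eq_stdAddChar,
    ← AddChar.map_add_eq_mul]
  congr 1
  have : (((w + v).toNat : ℕ) : ZMod (2 ^ d)) = (w.toNat : ZMod (2 ^ d)) + v.toNat := by
    rw [BitVec.toNat_add]
    have := ZMod.natCast_mod (w.toNat + v.toNat) (2 ^ d)
    push_cast at this ⊢
    exact this
  rw [this]
  ring

/-- The QFT adder adds the second register into the third. -/
theorem qftAdder_mulVec {n d : ℕ} (O : Matrix.unitaryGroup (Reg n d) ℂ) (x : PointReg n d)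
    (v w : BitVec d) :
    (Circuit.eval O (qftAdder n d)).1.mulVec (Pi.single ((x, v), w) 1) =
      Pi.single ((x, v), w + v) 1 := by
  simp only [qftAdder, Circuit.eval_cons_mulVec, Circuit.eval_nil_mulVec, Gate.eval]
  rw [← tensor_single, onRight_mulVec_tensor]
  have h1 : (diagonalGate (fun b : Reg n d => fourierPhase b.1.2 b.2)
      (fun _ => norm_fourierPhase _ _)).1.mulVec
        (tensor (Pi.single (x, v) 1) ((qft d).1.mulVec (Pi.single w 1))) =
      tensor (Pi.single (x, v) 1) ((qft d).1.mulVec (Pi.single (w + v) 1)) := by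
    funext ⟨⟨y, u⟩, a⟩
    simp only [diagonalGate, Matrix.mulVec_diagonal, tensor]
    by_cases h : (y, u) = (x, v)
    · obtain ⟨rfl, rfl⟩ := Prod.mk.inj h
      simp only [qft, qftMatrix, Matrix.mulVec_single_one, Matrix.col_apply, Matrix.of_apply,
        ← fourierPhase_add a u w]
      ring
    · simp [h]
  rw [h1, onRight_mulVec_tensor, Matrix.mulVec_mulVec]
  have h2 : (qft d)⁻¹.1 * (qft d).1 = 1 := congrArg Subtype.val (inv_mul_cancel (qft d))
  rw [h2, Matrix.one_mulVec, tensor_single]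

/-- The basis state that the search circuit prepares for the point `x`. -/
def pointState (d s : ℕ) {n : ℕ} (f : (Fin n → ℝ) → ℝ) (xk x : Fin n → ℝ) : Reg n d :=
  ((encodePoint d s x, encodeReal d s (f x)), -encodeReal d s (f xk) + encodeReal d s (f x))

variable {n d s : ℕ} {f : (Fin n → ℝ) → ℝ} {xk : Fin n → ℝ} {X : Finset (Fin n → ℝ)}
  {F : Matrix.unitaryGroup (PointReg n d × BitVec d) ℂ}
  {W : Matrix.unitaryGroup (PointReg n d) ℂ}

theorem searchCircuit_mulVec (hF : IsQuantumOracle d s f X F) (hW : PreparesUniform d s X W) :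
    (Circuit.eval (onLeft F) (searchCircuit W (encodeReal d s (f xk)))).1.mulVec
        (Pi.single (zeroReg n d) 1) =
      ∑ x ∈ X, (1 / (Real.sqrt X.card : ℂ)) • Pi.single (pointState d s f xk x) (1 : ℂ) := by
  rw [searchCircuit, Circuit.eval_append, Matrix.UnitaryGroup.mul_val, ← Matrix.mulVec_mulVec]
  simp only [Circuit.eval_cons_mulVec, Circuit.eval_nil_mulVec, Gate.eval]
  rw [zeroReg, ← tensor_single, onRight_mulVec_tensor, xorGate_mulVec_zero,
    onLeft_mulVec_tensor, ← tensor_single, onLeft_mulVec_tensor, onLeft_mulVec_tensor, hW]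
  have h1 : tensor (∑ x ∈ X, Pi.single (encodePoint d s x) (1 / (Real.sqrt X.card : ℂ)))
      (Pi.single 0#d 1) =
      ∑ x ∈ X, (1 / (Real.sqrt X.card : ℂ)) • Pi.single (encodePoint d s x, 0#d) (1 : ℂ) := by
    funext ⟨y, u⟩
    simp only [tensor, Finset.sum_apply, Pi.smul_apply, Finset.sum_mul, ← tensor_single,
      smul_eq_mul]
    refine Finset.sum_congr rfl fun x _ => ?_
    by_cases hy : y = encodePoint d s x <;> simp [Pi.single_apply, hy]
  have h2 : tensor (∑ x ∈ X, (1 / (Real.sqrt X.card : ℂ)) •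
      Pi.single (encodePoint d s x, encodeReal d s (f x)) (1 : ℂ))
      (Pi.single (-encodeReal d s (f xk)) 1) =
      ∑ x ∈ X, (1 / (Real.sqrt X.card : ℂ)) • Pi.single ((encodePoint d s x,
        encodeReal d s (f x)), -encodeReal d s (f xk)) (1 : ℂ) := by
    funext ⟨y, u⟩
    simp only [tensor, Finset.sum_apply, Pi.smul_apply, Finset.sum_mul, ← tensor_single,
      smul_eq_mul, mul_assoc]
  rw [h1, Matrix.mulVec_sum, Finset.sum_congr rfl fun x hx => (by
    rw [Matrix.mulVec_smul, hF x hx] : F.1.mulVec ((1 / (Real.sqrt X.card : ℂ)) •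
      Pi.single (encodePoint d s x, 0#d) (1 : ℂ)) = (1 / (Real.sqrt X.card : ℂ)) •
      Pi.single (encodePoint d s x, encodeReal d s (f x)) (1 : ℂ)), h2, Matrix.mulVec_sum]
  refine Finset.sum_congr rfl fun x _ => ?_
  rw [Matrix.mulVec_smul, qftAdder_mulVec, pointState]

theorem calls_searchCircuit (W : Matrix.unitaryGroup (PointReg n d) ℂ) (v : BitVec d) :
    Circuit.calls (searchCircuit W v) = 1 := by
  simp [searchCircuit, qftAdder, Circuit.calls, Gate.calls]

/-- The sign bit of the comparison register marks the points with a smaller objective value. -/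
theorem signBitSet_pointState (h : PrecisionSuffices d s f xk X) {x : Fin n → ℝ} (hx : x ∈ X) :
    signBitSet (pointState d s f xk x) ↔ f x < f xk := by
  have h1 : -encodeReal d s (f xk) + encodeReal d s (f x) =
      BitVec.ofInt d (quantize s (f x) - quantize s (f xk)) := by
    rw [encodeReal, encodeReal, ← BitVec.ofInt_neg, ← BitVec.ofInt_add]
    congr 1
    ring
  rw [signBitSet, pointState, h1, BitVec.msb_eq_toInt, h.no_overflow x hx, decide_eq_true_iff,
    sub_neg]
  -- Quantization is monotone, so a strict inequality between encoded values reflects one between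
  -- true values.
  refine ⟨fun hlt => ?_, h.resolves x hx⟩
  by_contra hle
  refine absurd hlt (not_lt.2 (Int.floor_le_floor ?_))
  have := not_lt.1 hle
  gcongr

theorem searchCircuit_apply (hF : IsQuantumOracle d s f X F) (hW : PreparesUniform d s X W)
    (b : Reg n d) :
    (Circuit.eval (onLeft F) (searchCircuit W (encodeReal d s (f xk)))).1 b (zeroReg n d) =
      ∑ x ∈ X, if b = pointState d s f xk x then 1 / (Real.sqrt X.card : ℂ) else 0 := by
  have h := congrFun (searchCircuit_mulVec (xk := xk) hF hW) b
  rw [Matrix.mulVec_single_one, Matrix.col_apply, Finset.sum_apply] at h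
  rw [h]
  refine Finset.sum_congr rfl fun x _ => ?_
  simp [Pi.single_apply]

/-- The search circuit finds a point with a smaller objective value with probability `t / N`. -/
theorem weight_searchCircuit (h : PrecisionSuffices d s f xk X) (hF : IsQuantumOracle d s f X F)
    (hW : PreparesUniform d s X W) :
    weight (Circuit.eval (onLeft F) (searchCircuit W (encodeReal d s (f xk)))) (zeroReg n d)
      signBitSet = ((X.filter fun x => f x < f xk).card : ℝ) / X.card := by
  -- Distinct points occupy distinct basis states, so amplitudes do not interfere and each point has
  -- probability `1 / N`.
  have hinj : Set.InjOn (pointState d s f xk) (X : Set (Fin n → ℝ)) := by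
    intro x hx y hy hxy
    exact h.injOn hx hy (congrArg (fun b => b.1.1) hxy)
  have hsq : ∀ b, ‖(Circuit.eval (onLeft F)
      (searchCircuit W (encodeReal d s (f xk)))).1 b (zeroReg n d)‖ ^ 2 =
      ∑ x ∈ X, if b = pointState d s f xk x then 1 / (X.card : ℝ) else 0 := by
    intro b
    rw [searchCircuit_apply hF hW]
    by_cases hb : ∃ x ∈ X, b = pointState d s f xk x
    · obtain ⟨x, hx, rfl⟩ := hb
      rw [Finset.sum_eq_single x, Finset.sum_eq_single x]
      · simp
      · intro y hy hyx
        exact if_neg fun h => hyx (hinj hx hy h).symm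
      · exact fun h => absurd hx h
      · intro y hy hyx
        exact if_neg fun h => hyx (hinj hx hy h).symm
      · exact fun h => absurd hx h
    · push Not at hb
      rw [Finset.sum_eq_zero fun x hx => if_neg (hb x hx),
        Finset.sum_eq_zero fun x hx => if_neg (hb x hx)]
      simp
  have hsum : ∀ b : Reg n d, (if signBitSet b then ‖(Circuit.eval (onLeft F)
      (searchCircuit W (encodeReal d s (f xk)))).1 b (zeroReg n d)‖ ^ 2 else 0) =
      ∑ x ∈ X, if b = pointState d s f xk x then
        (if f x < f xk then 1 / (X.card : ℝ) else 0) else 0 := by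
    intro b
    rw [hsq]
    split_ifs with hb
    · refine Finset.sum_congr rfl fun x hx => ?_
      split_ifs with h1 h2
      · rfl
      · rw [h1, signBitSet_pointState h hx] at hb
        exact absurd hb h2
      · rfl
    · refine (Finset.sum_eq_zero fun x hx => ?_).symm
      split_ifs with h1 h2
      · rw [h1, signBitSet_pointState h hx] at hb
        exact absurd h2 hb
      · rfl
      · rfl
  rw [weight, Finset.sum_congr rfl fun b _ => hsum b, Finset.sum_comm]
  simp only [Finset.sum_ite_eq', Finset.mem_univ, if_true]
  rw [← Finset.sum_filter, Finset.sum_const, nsmul_eq_mul, mul_one_div]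

end SearchCircuit

end QuantumSearch
end
-- The quantum search step.
theorem theorem2 (c : ℝ) (hc : 1 < c) (hc2 : c < 2) :
    ∃ κ₁ κ₂ : ℝ, 0 < κ₁ ∧ 0 < κ₂ ∧
      ∀ (n p d s : ℕ) (f : (Fin n → ℝ) → ℝ) (xk : Fin n → ℝ) (Δ : ℝ)
        (D : Matrix (Fin n) (Fin p) ℝ) (X : Finset (Fin n → ℝ))
        (F : Matrix.unitaryGroup (PointReg n d × BitVec d) ℂ)
        (W : Matrix.unitaryGroup (PointReg n d) ℂ) (τ : ℝ) (N t : ℕ),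
        0 < Δ → IsPatternMatrix D → (∀ x ∈ X, x ∈ mesh xk Δ D) →
        X.card = N → (improvedMeshPoints f xk Δ D X).card = t →
        PrecisionSuffices d s f xk X → IsQuantumOracle d s f X F → PreparesUniform d s X W →
        0 < τ →
        ∃ K : ℕ, ∀ k ≥ K,
          -- every execution has halted, with an improved mesh point or with failure
          (∀ σ ∈ (quantumSearchStep s f xk X F W τ c hc k).support,
            (∃ (b : Reg n d) (m : ℕ), σ = SearchState.found b m ∧
              ∃ x ∈ improvedMeshPoints f xk Δ D X, b.1.1 = encodePoint d s x) ∨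
            ∃ m : ℕ, σ = SearchState.failed m) ∧
          -- if there is an improved mesh point
          (0 < t →
            prob (quantumSearchStep s f xk X F W τ c hc k) SearchState.IsFailed
                < ENNReal.ofReal τ ∧
            expectedCalls (quantumSearchStep s f xk X F W τ c hc k)
                ≤ ENNReal.ofReal (κ₂ * Real.sqrt (N / t)) ∧
            expectedCallsIfFound (quantumSearchStep s f xk X F W τ c hc k)
                ≤ ENNReal.ofReal (κ₂ * Real.sqrt (N / t)) ∧
            (τ < 1 →
              ENNReal.ofReal (κ₁ * Real.sqrt (N / t))
                  ≤ expectedCalls (quantumSearchStep s f xk X F W τ c hc k) ∧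
              ENNReal.ofReal (κ₁ * Real.sqrt (N / t))
                  ≤ expectedCallsIfFound (quantumSearchStep s f xk X F W τ c hc k))) := by
  obtain ⟨κ₁, κ₂, h₁, h₂, hbounds⟩ := modifiedQSearch_bounds hc hc2
  refine ⟨κ₁, κ₂, h₁, h₂, ?_⟩
  intro n p d s f xk Δ D X F W τ N t _ _ hX hN ht hprec hF hW hτ
  -- All of `X` lies on the mesh, so improvement is the inequality that the sign bit tests.
  have himp : improvedMeshPoints f xk Δ D X = X.filter fun x => f x < f xk := by
    classical
    ext x
    simp only [improvedMeshPoints, IsImprovedMeshPoint, Finset.mem_filter]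
    exact ⟨fun h => ⟨h.1, h.2.2⟩, fun h => ⟨h.1, hX x h.1, h.2⟩⟩
  have hw := weight_searchCircuit hprec hF hW
  rw [← himp, ht, hN] at hw
  have htN : t ≤ N := by
    rw [← ht, ← hN, himp]
    exact Finset.card_filter_le _ _
  obtain ⟨K, hK⟩ := modifiedQSearch_halts (onLeft F)
    (searchCircuit W (encodeReal d s (f xk))) (zeroReg n d) signBitSet X.card τ c hc
  refine ⟨K, fun k hk => ⟨fun σ hσ => ?_, fun htpos => ?_⟩⟩
  · rcases hK k hk σ hσ with ⟨b, m, rfl, hgood, hb⟩ | h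
    · left
      refine ⟨b, m, rfl, ?_⟩
      -- A nonzero amplitude identifies `b` as the state of some point of `X`; its sign bit then
      -- shows the improvement.
      rw [searchCircuit_apply hF hW] at hb
      obtain ⟨x, hx, hbx⟩ := Finset.exists_ne_zero_of_sum_ne_zero hb
      have hbx' : b = pointState d s f xk x := by
        by_contra hne
        exact hbx (if_neg hne)
      subst hbx'
      refine ⟨x, ?_, rfl⟩
      rw [himp, Finset.mem_filter]
      exact ⟨hx, (signBitSet_pointState hprec hx).1 hgood⟩
    · exact Or.inr h
  · rw [quantumSearchStep, hN]
    refine hbounds _ _ _ _ N t τ k (calls_searchCircuit W _) htpos htN hw hτ fun σ hσ => ?_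
    rw [← hN] at hσ
    rcases hK k hk σ hσ with ⟨b, m, rfl, -⟩ | ⟨m, rfl⟩
    · exact Or.inl trivial
    · exact Or.inr trivial
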